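/- Let $X,Y,W\in\mathbb R[t]$ with $W\neq 0$ and $\gcd(X,Y,W)=1$, let $d>0$, and suppose that the parametrization $\phi=(X/W,\,Y/W)$ of the real plane curve $\mathcal C$ is proper, i.e. birational onto $\mathcal C$ (equivalently, $\mathbb R(X/W,Y/W)=\mathbb R(t)$). Put $U=X'W-XW'$, $V=Y'W-YW'$, $\widehat U=U/\gcd(U,V)$, $\widehat V=V/\gcd(U,V)$. The offset $\mathcal O_d(\mathcal C)\subset\mathbb R^2$ is the Zariski closure of the set of all points $$\Big(\tfrac{X(t)}{W(t)}\pm d\,\tfrac{V(t)}{\sqrt{U(t)^2+V(t)^2}},\ \tfrac{Y(t)}{W(t)}\mp d\,\tfrac{U(t)}{\sqrt{U(t)^2+V(t)^2}}\Big),\qquad t\in\mathbb R,\ W(t)\neq0,\ (U(t),V(t))\neq(0,0).$$ Let $\mathcal M$ be the curve $\alpha^2-(\widehat U(t)^2+\widehat V(t)^2)=0$ in the $(t,\alpha)$-plane, and assume that it is irreducible, i.e. that this polynomial is irreducible in $\mathbb R[t,\alpha]$. Let $$\varphi(t,\alpha)=\Big(\tfrac{X(t)}{W(t)}+d\,\tfrac{\widehat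 V(t)}{\alpha},\ \tfrac{Y(t)}{W(t)}-d\,\tfrac{\widehat U(t)}{\alpha}\Big).$$ Let $P,Q\in\mathbb R[x,y][t]$ be obtained from $$\tilde P=U\,(Wx-X)+V\,(Wy-Y),\qquad \tilde Q=(Wx-X)^2+(Wy-Y)^2-d^2W^2$$ by dividing each by its $t$-content (the gcd in $\mathbb R[t]$ of its coefficients as a polynomial in $x,y$). Let $n=\deg_tP$, $m=\deg_tQ$. The first subresultant $\mathbf{Subres}_1(P,n,Q,m)$ is the determinant polynomial of the $(n+m-2)\times(n+m-1)$ Sylvester matrix of index $1$, whose first $m-1$ rows are the shifts of the coefficient vector of $P$ and whose last $n-1$ rows are the shifts of the coefficient vector of $Q$ (coefficients with respect to $t$, highest power first). That is, $\mathbf{Subres}_1=\mathbf{sres}_1(x,y)\,t+\mathrm{sr}(x,y)\in\mathbb R[x,y][t]$, where $\mathbf{sres}_1$ and $\mathrm{sr}$ are the minors obtained by deleting the last column and the next-to-last column, respectively. Then: 1. $\mathcal O_d(\mathcal C)$ is irreducible, and $\varphi$ is a birational map $\mathcal M\dashrightarrow\mathcal O_d(\mathcal C)$ over $\mathbb R$: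 there is an isomorphism of $\mathbb R$-algebras $\Phi=\varphi^*:\mathbb R(\mathcal O_d(\mathcal C))\to\mathbb R(\mathcal M)$ between the fields of rational functions that sends the coordinate functions $x,y$ to the two components of $\varphi$. Moreover $\mathbf{sres}_1$ does not vanish identically on $\mathcal O_d(\mathcal C)$, and the $t$-component $t^{-1}(x,y)=\Phi^{-1}(t)$ of the inverse map $\varphi^{-1}$ is $$t^{-1}(x,y)=-\frac{\mathrm{sr}(x,y)}{\mathbf{sres}_1(x,y)}\quad\text{in }\mathbb R(\mathcal O_d(\mathcal C)).$$ 2. For every point $(x_0,y_0)\in\mathcal O_d(\mathcal C)$ with $\mathbf{sres}_1(x_0,y_0)\neq0$ there is exactly one real point $(t_0,\alpha_0)\in\mathcal M$ with $W(t_0)\neq0$, $\alpha_0\neq0$ and $\varphi(t_0,\alpha_0)=(x_0,y_0)$, and $t_0=-\mathrm{sr}(x_0,y_0)/\mathbf{sres}_1(x_0,y_0)$. -/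

import Mathlib

open scoped Polynomial

namespace OffsetCurve

noncomputable section

/-! ### Subresultants -/

section Subresultants

variable {D : Type*} [CommRing D]

/-- The Sylvester matrix of index `i` of `f = a_n t^n + ⋯ + a_0` and `g = b_m t^m + ⋯ + b_0`:
its first `m - i` rows are the shifts of `(a_n, …, a_0)`, its last `n - i` rows are the shifts of
`(b_m, …, b_0)`. -/
def sylv (i : ℕ) (f : D[X]) (n : ℕ) (g : D[X]) (m : ℕ) :
    Matrix (Fin (n + m - 2 * i)) (Fin (n + m - i)) D :=
  Matrix.of fun r c =>
    if (r : ℕ) < m - i then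
      if (r : ℕ) ≤ c ∧ (c : ℕ) ≤ r + n then f.coeff (n - (c - r)) else 0
    else
      if (r : ℕ) - (m - i) ≤ c ∧ (c : ℕ) ≤ (r - (m - i)) + m then
        g.coeff (m - (c - (r - (m - i)))) else 0

/-- For an `a × b` matrix `Δ` with `a ≤ b`, the square submatrix of `Δ` made of its first `a - 1`
columns and its `(k + a)`-th column (columns counted from `1`, and `0 ≤ k ≤ b - a`). -/
def detpolMinor {a b : ℕ} (h : a ≤ b) (Δ : Matrix (Fin a) (Fin b) D) (k : Fin (b - a + 1)) :
    Matrix (Fin a) (Fin a) D :=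
  Δ.submatrix id fun j =>
    ⟨if (j : ℕ) + 1 < a then j else a - 1 + k, by
      have := j.isLt
      have := k.isLt
      split <;> omega⟩

/-- The determinant polynomial of an `a × b` matrix, `a ≤ b`. -/
def detpol {a b : ℕ} (h : a ≤ b) (Δ : Matrix (Fin a) (Fin b) D) : D[X] :=
  ∑ k : Fin (b - a + 1),
    Polynomial.C (detpolMinor h Δ k).det * Polynomial.X ^ (b - a - (k : ℕ))

/-- The `i`-th subresultant polynomial `Subres_i(f, n, g, m)`. -/
def subres (i : ℕ) (f : D[X]) (n : ℕ) (g : D[X]) (m : ℕ) : D[X] :=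
  detpol (by omega) (sylv i f n g m)

end Subresultants

/-! ### The generator curve, given by the parametrization `(X / W, Y / W)` -/

/-- The parametrization `(X / W, Y / W)` is proper, that is, birational onto the curve that it
parametrizes: the rational functions `X / W` and `Y / W` generate the field `ℝ(t)`. -/
def IsProper (X Y W : ℝ[X]) : Prop :=
  IntermediateField.adjoin ℝ
    ({algebraMap ℝ[X] (RatFunc ℝ) X / algebraMap ℝ[X] (RatFunc ℝ) W,
      algebraMap ℝ[X] (RatFunc ℝ) Y / algebraMap ℝ[X] (RatFunc ℝ) W} : Set (RatFunc ℝ)) = ⊤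

/-- `U = X' W - X W'`. -/
def polyU (X W : ℝ[X]) : ℝ[X] := X.derivative * W - X * W.derivative

/-- `V = Y' W - Y W'`. -/
def polyV (Y W : ℝ[X]) : ℝ[X] := Y.derivative * W - Y * W.derivative

/-- `Û = U / gcd (U, V)`. -/
def hatU (X Y W : ℝ[X]) : ℝ[X] :=
  polyU X W / EuclideanDomain.gcd (polyU X W) (polyV Y W)

/-- `V̂ = V / gcd (U, V)`. -/
def hatV (X Y W : ℝ[X]) : ℝ[X] :=
  polyV Y W / EuclideanDomain.gcd (polyU X W) (polyV Y W)

/-! ### The offset -/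

/-- The points `(X/W ± d V/√(U²+V²), Y/W ∓ d U/√(U²+V²))(t)` for those real `t` for which the
formula makes sense. -/
def offsetPoints (X Y W : ℝ[X]) (d : ℝ) : Set (Fin 2 → ℝ) :=
  {p | ∃ t ε : ℝ, W.eval t ≠ 0 ∧ (polyU X W).eval t ^ 2 + (polyV Y W).eval t ^ 2 ≠ 0 ∧
    (ε = 1 ∨ ε = -1) ∧
    p 0 = X.eval t / W.eval t + ε * (d * (polyV Y W).eval t /
      √((polyU X W).eval t ^ 2 + (polyV Y W).eval t ^ 2)) ∧
    p 1 = Y.eval t / W.eval t - ε * (d * (polyU X W).eval t /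
      √((polyU X W).eval t ^ 2 + (polyV Y W).eval t ^ 2))}

/-- The offset `O_d(C)`: the Zariski closure of `offsetPoints`. -/
def offset (X Y W : ℝ[X]) (d : ℝ) : Set (Fin 2 → ℝ) :=
  MvPolynomial.zeroLocus ℝ (MvPolynomial.vanishingIdeal ℝ (offsetPoints X Y W d))

/-- The ideal in `ℝ[x, y]` of the polynomials that vanish on the offset. -/
def offsetIdeal (X Y W : ℝ[X]) (d : ℝ) : Ideal (MvPolynomial (Fin 2) ℝ) :=
  MvPolynomial.vanishingIdeal ℝ (offset X Y W d)

/-! ### The auxiliary curve `M` -/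

/-- The polynomial `α² - (Û(t)² + V̂(t)²)` in `ℝ[t, α]`; here `t` is the variable `0` and `α` is
the variable `1`. -/
def auxPoly (X Y W : ℝ[X]) : MvPolynomial (Fin 2) ℝ :=
  MvPolynomial.X 1 ^ 2 - (Polynomial.aeval (MvPolynomial.X 0) (hatU X Y W) ^ 2 +
    Polynomial.aeval (MvPolynomial.X 0) (hatV X Y W) ^ 2)

/-- The ideal of `ℝ[t, α]` that defines the curve `M`. -/
def auxIdeal (X Y W : ℝ[X]) : Ideal (MvPolynomial (Fin 2) ℝ) :=
  Ideal.span {auxPoly X Y W}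

/-- The real points of the curve `M`. -/
def auxCurve (X Y W : ℝ[X]) : Set (Fin 2 → ℝ) :=
  {q | MvPolynomial.eval q (auxPoly X Y W) = 0}

instance auxIdeal_isPrime (X Y W : ℝ[X]) [h : Fact (Irreducible (auxPoly X Y W))] :
    (auxIdeal X Y W).IsPrime :=
  (Ideal.span_singleton_prime h.out.ne_zero).2 h.out.prime

/-! ### Rational functions on an irreducible plane curve -/

/-- The field of rational functions of the plane curve with the (prime) ideal `I`. -/
abbrev FunField (I : Ideal (MvPolynomial (Fin 2) ℝ)) : Type :=
  FractionRing (MvPolynomial (Fin 2) ℝ ⧸ I)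

/-- The rational function that a polynomial in two variables defines on the curve. -/
def ratFun (I : Ideal (MvPolynomial (Fin 2) ℝ)) (f : MvPolynomial (Fin 2) ℝ) : FunField I :=
  algebraMap (MvPolynomial (Fin 2) ℝ ⧸ I) (FunField I) (Ideal.Quotient.mk I f)

/-- The rational function on `M` that a polynomial in `t` defines. -/
def auxFun (X Y W f : ℝ[X]) : FunField (auxIdeal X Y W) :=
  ratFun (auxIdeal X Y W) (Polynomial.aeval (MvPolynomial.X 0) f)

/-! ### The map `φ(t, α) = (X/W + d V̂/α, Y/W - d Û/α)` from `M` to the offset -/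

/-- The first component of `φ`, as a rational function on `M`. -/
def mapX (X Y W : ℝ[X]) (d : ℝ) [Fact (Irreducible (auxPoly X Y W))] :
    FunField (auxIdeal X Y W) :=
  auxFun X Y W X / auxFun X Y W W + algebraMap ℝ (FunField (auxIdeal X Y W)) d *
    (auxFun X Y W (hatV X Y W) / ratFun (auxIdeal X Y W) (MvPolynomial.X 1))

/-- The second component of `φ`, as a rational function on `M`. -/
def mapY (X Y W : ℝ[X]) (d : ℝ) [Fact (Irreducible (auxPoly X Y W))] :
    FunField (auxIdeal X Y W) :=
  auxFun X Y W Y / auxFun X Y W W - algebraMap ℝ (FunField (auxIdeal X Y W)) d *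
    (auxFun X Y W (hatU X Y W) / ratFun (auxIdeal X Y W) (MvPolynomial.X 1))

/-- The real points `(t, α)` of `M` with `W(t) ≠ 0` and `α ≠ 0`, at which `φ` is defined. -/
def mapDomain (X Y W : ℝ[X]) : Set (Fin 2 → ℝ) :=
  {q | q ∈ auxCurve X Y W ∧ W.eval (q 0) ≠ 0 ∧ q 1 ≠ 0}

/-- The value of `φ` at a point `q = (t, α)`. -/
def mapPoint (X Y W : ℝ[X]) (d : ℝ) (q : Fin 2 → ℝ) : Fin 2 → ℝ :=
  ![X.eval (q 0) / W.eval (q 0) + d * ((hatV X Y W).eval (q 0) / q 1),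
    Y.eval (q 0) / W.eval (q 0) - d * ((hatU X Y W).eval (q 0) / q 1)]

/-! ### The polynomials `P` and `Q`, in `ℝ[x, y][t]` -/

/-- The inclusion of `ℝ[t]` into `ℝ[x, y][t]`. -/
def lift (f : ℝ[X]) : (MvPolynomial (Fin 2) ℝ)[X] := f.map MvPolynomial.C

/-- The variable `x`, as an element of `ℝ[x, y][t]`. -/
def varx : (MvPolynomial (Fin 2) ℝ)[X] := Polynomial.C (MvPolynomial.X 0)

/-- The variable `y`, as an element of `ℝ[x, y][t]`. -/
def vary : (MvPolynomial (Fin 2) ℝ)[X] := Polynomial.C (MvPolynomial.X 1)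

/-- `P̃ = U (W x - X) + V (W y - Y)`. -/
def tildeP (X Y W : ℝ[X]) : (MvPolynomial (Fin 2) ℝ)[X] :=
  lift (polyU X W) * (lift W * varx - lift X) + lift (polyV Y W) * (lift W * vary - lift Y)

/-- `Q̃ = (W x - X)² + (W y - Y)² - d² W²`. -/
def tildeQ (X Y W : ℝ[X]) (d : ℝ) : (MvPolynomial (Fin 2) ℝ)[X] :=
  (lift W * varx - lift X) ^ 2 + (lift W * vary - lift Y) ^ 2
    - lift (Polynomial.C (d ^ 2) * W ^ 2)

/-- The `t`-content of `P̃`: the gcd of the coefficients `U W`, `V W`, `-(U X + V Y)` of `P̃`,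
seen as a polynomial in `x, y` over `ℝ[t]`. -/
def contP (X Y W : ℝ[X]) : ℝ[X] :=
  EuclideanDomain.gcd
    (EuclideanDomain.gcd (polyU X W * W) (polyV Y W * W)) (polyU X W * X + polyV Y W * Y)

/-- The `t`-content of `Q̃`: the gcd of the coefficients `W²`, `-2 W X`, `-2 W Y`,
`X² + Y² - d² W²` of `Q̃`, seen as a polynomial in `x, y` over `ℝ[t]`. -/
def contQ (X Y W : ℝ[X]) (d : ℝ) : ℝ[X] :=
  EuclideanDomain.gcd (EuclideanDomain.gcd (W ^ 2) (EuclideanDomain.gcd (2 * W * X) (2 * W * Y)))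
    (X ^ 2 + Y ^ 2 - Polynomial.C (d ^ 2) * W ^ 2)

/-- `P`, the quotient of `P̃` by its `t`-content. -/
def polyP (X Y W : ℝ[X]) : (MvPolynomial (Fin 2) ℝ)[X] :=
  lift (polyU X W * W / contP X Y W) * varx + lift (polyV Y W * W / contP X Y W) * vary
    - lift ((polyU X W * X + polyV Y W * Y) / contP X Y W)

/-- `Q`, the quotient of `Q̃` by its `t`-content. -/
def polyQ (X Y W : ℝ[X]) (d : ℝ) : (MvPolynomial (Fin 2) ℝ)[X] :=
  lift (W ^ 2 / contQ X Y W d) * (varx ^ 2 + vary ^ 2)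
    - lift (2 * W * X / contQ X Y W d) * varx - lift (2 * W * Y / contQ X Y W d) * vary
    + lift ((X ^ 2 + Y ^ 2 - Polynomial.C (d ^ 2) * W ^ 2) / contQ X Y W d)

theorem lift_mul_div {a b : ℝ[X]} (h : b ∣ a) : lift b * lift (a / b) = lift a := by
  unfold lift
  rw [← Polynomial.map_mul]
  rcases eq_or_ne b 0 with rfl | hb
  · rw [zero_dvd_iff.1 h, zero_mul]
  · rw [EuclideanDomain.mul_div_cancel' hb h]

theorem lift_contP_mul_polyP (X Y W : ℝ[X]) :
    lift (contP X Y W) * polyP X Y W = tildeP X Y W := by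
  have h1 : contP X Y W ∣ polyU X W * W :=
    (EuclideanDomain.gcd_dvd_left _ _).trans (EuclideanDomain.gcd_dvd_left _ _)
  have h2 : contP X Y W ∣ polyV Y W * W :=
    (EuclideanDomain.gcd_dvd_left _ _).trans (EuclideanDomain.gcd_dvd_right _ _)
  have h3 : contP X Y W ∣ polyU X W * X + polyV Y W * Y := EuclideanDomain.gcd_dvd_right _ _
  have e1 := lift_mul_div h1
  have e2 := lift_mul_div h2
  have e3 := lift_mul_div h3
  simp only [polyP, tildeP, mul_add, mul_sub, ← mul_assoc, e1, e2, e3]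
  simp only [lift, Polynomial.map_mul, Polynomial.map_add]
  ring

theorem lift_contQ_mul_polyQ (X Y W : ℝ[X]) (d : ℝ) :
    lift (contQ X Y W d) * polyQ X Y W d = tildeQ X Y W d := by
  have h1 : contQ X Y W d ∣ W ^ 2 :=
    (EuclideanDomain.gcd_dvd_left _ _).trans (EuclideanDomain.gcd_dvd_left _ _)
  have h0 : contQ X Y W d ∣ EuclideanDomain.gcd (2 * W * X) (2 * W * Y) :=
    (EuclideanDomain.gcd_dvd_left _ _).trans (EuclideanDomain.gcd_dvd_right _ _)
  have h2 := h0.trans (EuclideanDomain.gcd_dvd_left _ _)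
  have h3 := h0.trans (EuclideanDomain.gcd_dvd_right _ _)
  have h4 : contQ X Y W d ∣ X ^ 2 + Y ^ 2 - Polynomial.C (d ^ 2) * W ^ 2 :=
    EuclideanDomain.gcd_dvd_right _ _
  have e1 := lift_mul_div h1
  have e2 := lift_mul_div h2
  have e3 := lift_mul_div h3
  have e4 := lift_mul_div h4
  simp only [polyQ, tildeQ, mul_add, mul_sub, ← mul_assoc, e1, e2, e3, e4]
  simp only [lift, Polynomial.map_mul, Polynomial.map_add, Polynomial.map_sub,
    Polynomial.map_pow, Polynomial.map_ofNat]
  ring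

/-! ### The first subresultant of `P` and `Q` -/

/-- `Subres_1(P, Q)`, computed in `ℝ[x, y][t]`, for the degrees of `P` and `Q` in `t`. -/
def subresPQ (X Y W : ℝ[X]) (d : ℝ) : (MvPolynomial (Fin 2) ℝ)[X] :=
  subres 1 (polyP X Y W) (polyP X Y W).natDegree (polyQ X Y W d) (polyQ X Y W d).natDegree

/-- The principal coefficient `sres_1(x, y)`, that is, the coefficient of `t`. -/
def sres₁ (X Y W : ℝ[X]) (d : ℝ) : MvPolynomial (Fin 2) ℝ := (subresPQ X Y W d).coeff 1

/-- The constant coefficient `sr(x, y)`. -/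
def sr (X Y W : ℝ[X]) (d : ℝ) : MvPolynomial (Fin 2) ℝ := (subresPQ X Y W d).coeff 0

theorem natDegree_detpol_le {D : Type*} [CommRing D] {a b : ℕ} (h : a ≤ b)
    (Δ : Matrix (Fin a) (Fin b) D) : (detpol h Δ).natDegree ≤ b - a := by
  refine Polynomial.natDegree_sum_le_of_forall_le _ _ fun k _ => ?_
  exact (Polynomial.natDegree_C_mul_X_pow_le _ _).trans (Nat.sub_le _ _)

theorem subresPQ_eq (X Y W : ℝ[X]) (d : ℝ) :
    subresPQ X Y W d =
      Polynomial.C (sres₁ X Y W d) * Polynomial.X + Polynomial.C (sr X Y W d) := by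
  refine Polynomial.eq_X_add_C_of_natDegree_le_one ?_
  refine (natDegree_detpol_le _ _).trans ?_
  omega

end

end OffsetCurve

/-!
The function field `K = ℝ(M)` of the auxiliary curve `α² = Û(t)² + V̂(t)²` carries a generic point
`(a, b) = φ(t, α)` of the offset. Over every real `t` there are two real points of `M`, so the
real points are Zariski dense in `M` (`mem_auxIdeal_iff`). Hence the offset ideal is the kernel of
the substitution `ℝ[x, y] → K` of `(a, b)` (`mem_offsetIdeal_iff`); it is prime, and `φ^*` embeds
the function field of the offset into `K`. The two points over `t` also show that `1` and `α` are
linearly independent over `ℝ(t)` (`aeval_add_mul_auxA_eq_zero`), and that `-1` is not a square in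
`K`.

The main step is that `t` is the only common root of `P` and `Q` at `(a, b)`, in an algebraic
closure `L` of `K` (`eq_auxT_of_common_root`). Let `s` be a common root.

* The offset is not contained in a line (`offset_linearIndependent`), and `P` is linear in `x, y`
  with coprime coefficients in `ℝ[t]`. So `s` is not algebraic over `ℝ`: it would be a complex
  number, and the real and imaginary parts of `P(s) = 0` would be equations of lines through
  `(a, b)` (`transcendental_of_eval₂_polyP_eq_zero`). Therefore `(a, b)` is also the image under
  `φ` of a generic point `(s, β)` of `M`, which amounts to a homomorphism `K → L` that fixes `a`
  and `b`.
* The derivation `d/dt` of `K` shows that the tangent direction of the offset at `(a, b)` is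
  `(Û, V̂)` (`exists_derivation_offset`). By differentiation of an equation between `a` and `b`,
  this direction is determined by `(a, b)` over `ℝ` (`exists_linear_relation`). So the curve has
  the same normal direction at `s` as at `t`, and the unit normal vectors at `s` and `t` agree up
  to sign.
* If they are equal, `s` and `t` parametrize the same point of the curve, and `s = t` because the
  parametrization is proper (`IsProper.eq_of_transcendental`).
* If they are opposite, the points at `s` and `t` differ by `2 d` times the normal vector. After a
  change of sign of `β` there is a homomorphism `K → L` that fixes the coordinate `V̂ / α` of the
  normal and translates `X / W` by `2 d V̂ / α`. As `K` has transcendence degree `1`, `X / W` is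
  algebraic over `ℝ(V̂ / α)`, and iteration of the translation gives infinitely many roots of one
  equation (`algHom_ne_translation`).

Since `t` is a simple root of `P` (`eval_derivative_map_polyP_ne_zero`), the greatest common
divisor of `P` and `Q` at the generic point is linear, so `sres₁` does not vanish there
(`subres_one_coeff_one_ne_zero`, `genericHom_sres₁_ne_zero`). A common root `s` of `P` and `Q` at
any point satisfies `sres₁ s + sr = 0` (`sres₁_mul_add_sr_eq_zero`), hence `t = - sr / sres₁` in
`K`; then `α` is a rational function of `a`, `b` as well, and `φ^*` is an isomorphism.

For a real point of the offset with `sres₁ ≠ 0`, the equations `P = Q = 0` specialize to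
`t₀ = - sr / sres₁` (`eval₂_eq_zero_of_mem_offset`), and `W(t₀) ≠ 0` by the coprimality of `X`,
`Y` and `W`. Common real roots of `P` and `Q` with `W ≠ 0` are exactly the values `t` of the
preimages under `φ` (`mapPoint_eq_iff`). This gives existence; uniqueness follows from
`sres₁ t + sr = 0`.
-/

namespace OffsetCurve

/-! ### The first subresultant -/

section Subresultants

variable {D : Type*} [CommRing D]

theorem coeff_detpol {a b : ℕ} (h : a ≤ b) (Δ : Matrix (Fin a) (Fin b) D) {j : ℕ}
    (hj : j ≤ b - a) :
    (detpol h Δ).coeff j = (detpolMinor h Δ ⟨b - a - j, by omega⟩).det := by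
  rw [detpol, Polynomial.finsetSum_coeff, Finset.sum_eq_single ⟨b - a - j, by omega⟩]
  · rw [Polynomial.coeff_C_mul, Polynomial.coeff_X_pow, if_pos (by simp; omega), mul_one]
  · intro k _ hk
    rw [Polynomial.coeff_C_mul, Polynomial.coeff_X_pow, if_neg, mul_zero]
    intro hjk
    have := k.isLt
    exact hk (Fin.ext (by simp; omega))
  · simp

theorem map_subres {E : Type*} [CommRing E] (ψ : D →+* E) (i : ℕ) (f : D[X]) (n : ℕ) (g : D[X])
    (m : ℕ) : (subres i f n g m).map ψ = subres i (f.map ψ) n (g.map ψ) m := by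
  have hs : sylv i (f.map ψ) n (g.map ψ) m = (sylv i f n g m).map ψ := by
    ext r c
    simp only [sylv, Matrix.of_apply, Matrix.map_apply, Polynomial.coeff_map]
    split_ifs <;> simp
  simp only [subres, detpol, Polynomial.map_sum, Polynomial.map_mul, Polynomial.map_C,
    Polynomial.map_pow, Polynomial.map_X, hs]
  refine Finset.sum_congr rfl fun k _ => ?_
  rw [ψ.map_det]
  rfl

/-- The polynomial whose coefficient vector is the `r`-th row of the Sylvester matrix of
index `1`. -/
noncomputable def sylvRow (f : D[X]) (n : ℕ) (g : D[X]) (m r : ℕ) : D[X] :=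
  if r < m - 1 then Polynomial.X ^ (m - 2 - r) * f
  else Polynomial.X ^ (n - 2 - (r - (m - 1))) * g

theorem sylv_one_apply {f g : D[X]} {n m : ℕ} (hf : f.natDegree ≤ n) (hg : g.natDegree ≤ m)
    (r : Fin (n + m - 2 * 1)) (c : Fin (n + m - 1)) :
    sylv 1 f n g m r c = (sylvRow f n g m r).coeff (n + m - 2 - c) := by
  have hr := r.isLt
  have hc := c.isLt
  have key : ∀ (p : D[X]) (k j l : ℕ), p.natDegree ≤ k → n + m - 2 = k + l + j →
      (if j ≤ (c : ℕ) ∧ (c : ℕ) ≤ j + k then p.coeff (k - (c - j)) else 0) =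
        (Polynomial.X ^ l * p).coeff (n + m - 2 - c) := by
    intro p k j l hp hl
    rw [Polynomial.coeff_X_pow_mul']
    split_ifs with h1 h2 h2
    · congr 1; omega
    · omega
    · exact (Polynomial.coeff_eq_zero_of_natDegree_lt (by omega)).symm
    · rfl
  simp only [sylv, sylvRow, Matrix.of_apply]
  split_ifs with h
  · rw [← key f n r (m - 2 - r) hf (by omega), if_pos (by assumption)]
  · rw [← key f n r (m - 2 - r) hf (by omega), if_neg (by assumption)]
  · rw [← key g m (r - (m - 1)) (n - 2 - (r - (m - 1))) hg (by omega), if_pos (by assumption)]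
  · rw [← key g m (r - (m - 1)) (n - 2 - (r - (m - 1))) hg (by omega), if_neg (by assumption)]

theorem natDegree_sylvRow_le {f g : D[X]} {n m : ℕ} (hf : f.natDegree ≤ n) (hg : g.natDegree ≤ m)
    (hm : 1 ≤ m) {r : ℕ} (hr : r < n + m - 2) :
    (sylvRow f n g m r).natDegree ≤ n + m - 2 := by
  unfold sylvRow
  split_ifs <;>
  · refine Polynomial.natDegree_mul_le.trans ?_
    have := Polynomial.natDegree_X_pow_le (R := D) (m - 2 - r)
    have := Polynomial.natDegree_X_pow_le (R := D) (n - 2 - (r - (m - 1)))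
    omega

/-- If the vector `(s ^ (b - 1), …, s, 1)` lies in the kernel of an `a × b` matrix with
`b = a + 1`, then `s` is a root of the determinant polynomial of the matrix. -/
theorem detpol_eval_eq_zero {E : Type*} [CommRing E] [IsDomain E] {a b : ℕ} (ha : 1 ≤ a)
    (hab : b = a + 1) (h : a ≤ b) (S : Matrix (Fin a) (Fin b) E) {s : E}
    (hz : ∀ r, ∑ c : Fin b, S r c * s ^ (a - (c : ℕ)) = 0) :
    (detpol h S).coeff 1 * s + (detpol h S).coeff 0 = 0 := by
  rw [coeff_detpol _ _ (by omega), coeff_detpol _ _ (by omega)]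
  subst hab
  obtain ⟨a, rfl⟩ : ∃ k, a = k + 1 := ⟨a - 1, by omega⟩
  set M₁ := detpolMinor h S ⟨a + 1 + 1 - (a + 1) - 1, by omega⟩ with hM₁
  set M₀ := detpolMinor h S ⟨a + 1 + 1 - (a + 1) - 0, by omega⟩ with hM₀
  -- By linearity in the last column, the left side is a single determinant.
  have hdet : M₁.det * s + M₀.det =
      (M₁.updateCol (Fin.last a) (s • (fun r => M₁ r (Fin.last a)) +
        fun r => M₀ r (Fin.last a))).det := by
    rw [Matrix.det_updateCol_add, Matrix.det_updateCol_smul]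
    congr 1
    · rw [mul_comm]; congr 2; simp [Matrix.updateCol_eq_self]
    · congr 1
      ext r j
      rw [Matrix.updateCol_apply]
      split_ifs with hj
      · rw [hj]
      · have : (j : ℕ) < a := by
          have := j.isLt
          have : (j : ℕ) ≠ a := fun h' => hj (Fin.ext h')
          omega
        simp [hM₀, hM₁, detpolMinor, this]
  rw [hdet, ← Matrix.exists_mulVec_eq_zero_iff]
  refine ⟨fun j => if j = Fin.last a then 1 else s ^ (a + 1 - (j : ℕ)), ?_, ?_⟩
  · intro h'
    simpa using congrFun h' (Fin.last a)
  · ext r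
    have h' := hz r
    rw [Fin.sum_univ_castSucc, Fin.sum_univ_castSucc] at h'
    rw [Matrix.mulVec, dotProduct, Fin.sum_univ_castSucc, Pi.zero_apply, ← h', add_assoc]
    congr 1
    · refine Finset.sum_congr rfl fun j _ => ?_
      have hj := (Fin.castSucc_lt_last j).ne
      simp [hj, hM₁, detpolMinor]
      left; rfl
    · simp [hM₀, hM₁, detpolMinor, mul_comm]
      rfl

/-- A common root of `f` and `g` is a root of their first subresultant: the powers of the root
form a vector in the kernel of the Sylvester matrix of index `1`. -/
theorem subres_one_eval_eq_zero {E : Type*} [CommRing E] [IsDomain E] {f g : E[X]} {n m : ℕ}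
    (hf : f.natDegree ≤ n) (hg : g.natDegree ≤ m) (hm : 1 ≤ m) (hnm : 3 ≤ n + m)
    {s : E} (hfs : f.eval s = 0) (hgs : g.eval s = 0) :
    (subres 1 f n g m).coeff 1 * s + (subres 1 f n g m).coeff 0 = 0 := by
  have hz : ∀ r : Fin (n + m - 2 * 1),
      ∑ c : Fin (n + m - 1), sylv 1 f n g m r c * s ^ (n + m - 2 * 1 - (c : ℕ)) = 0 := by
    intro r
    have hrow : (sylvRow f n g m r).eval s = 0 := by
      unfold sylvRow; split_ifs <;> simp [hfs, hgs]
    rw [Polynomial.eval_eq_sum_range' (n := n + m - 1)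
      (by have := natDegree_sylvRow_le hf hg hm (r := r) (by have := r.isLt; omega); omega),
      ← Finset.sum_range_reflect, ← Fin.sum_univ_eq_sum_range
        (fun k => (sylvRow f n g m r).coeff (n + m - 1 - 1 - k) * s ^ (n + m - 1 - 1 - k))] at hrow
    rw [← hrow]
    exact Finset.sum_congr rfl fun c _ => by rw [sylv_one_apply hf hg]; rfl
  exact detpol_eval_eq_zero (by omega) (by omega) _ _ hz

/-- If the greatest common divisor of `f` and `g` is linear, the principal coefficient of the first
subresultant does not vanish: a vector in the left kernel of its matrix would give `u f + v g = 0`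
with `deg v < deg f - 1`. -/
theorem subres_one_coeff_one_ne_zero {E : Type*} [Field E] {p q : E[X]} (hpq : IsCoprime p q)
    (hp : p ≠ 0) (s : E) {n m : ℕ} (hn : p.natDegree + 1 = n)
    (hm : ((Polynomial.X - Polynomial.C s) * q).natDegree ≤ m) (hm1 : 1 ≤ m) (hnm : 3 ≤ n + m) :
    (subres 1 ((Polynomial.X - Polynomial.C s) * p) n
      ((Polynomial.X - Polynomial.C s) * q) m).coeff 1 ≠ 0 := by
  set f := (Polynomial.X - Polynomial.C s) * p with hf
  set g := (Polynomial.X - Polynomial.C s) * q with hg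
  have hfn : f.natDegree ≤ n := by
    rw [hf, Polynomial.natDegree_mul (Polynomial.X_sub_C_ne_zero s) hp,
      Polynomial.natDegree_X_sub_C]
    omega
  intro h0
  unfold subres at h0
  rw [coeff_detpol _ _ (by omega), ← Matrix.exists_vecMul_eq_zero_iff] at h0
  obtain ⟨w, hw0, hw⟩ := h0
  set u : E[X] := ∑ r : Fin (n + m - 2 * 1), if (r : ℕ) < m - 1 then
    Polynomial.C (w r) * Polynomial.X ^ (m - 2 - (r : ℕ)) else 0 with hu
  set v : E[X] := ∑ r : Fin (n + m - 2 * 1), if (r : ℕ) < m - 1 then 0 else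
    Polynomial.C (w r) * Polynomial.X ^ (n - 2 - ((r : ℕ) - (m - 1))) with hv
  have huv : u * f + v * g = ∑ r : Fin (n + m - 2 * 1), Polynomial.C (w r) * sylvRow f n g m r := by
    rw [hu, hv, Finset.sum_mul, Finset.sum_mul, ← Finset.sum_add_distrib]
    refine Finset.sum_congr rfl fun r _ => ?_
    unfold sylvRow
    split_ifs <;> ring
  -- All coefficients of `u f + v g` in positive degree are entries of the vanishing product.
  have hconst : (u * f + v * g).natDegree ≤ 0 := by
    rw [Polynomial.natDegree_le_iff_coeff_eq_zero]
    intro k hk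
    rw [huv]
    rcases lt_or_ge (n + m - 2) k with hk' | hk'
    · refine Polynomial.coeff_eq_zero_of_natDegree_lt (lt_of_le_of_lt ?_ hk')
      refine Polynomial.natDegree_sum_le_of_forall_le _ _ fun r _ => ?_
      exact (Polynomial.natDegree_C_mul_le _ _).trans
        (natDegree_sylvRow_le hfn hm hm1 (by have := r.isLt; omega))
    · have := congrFun hw ⟨n + m - 2 - k, by omega⟩
      rw [Pi.zero_apply, Matrix.vecMul, dotProduct] at this
      rw [Polynomial.finsetSum_coeff, ← this]
      refine Finset.sum_congr rfl fun r _ => ?_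
      rw [Polynomial.coeff_C_mul]
      congr 1
      simp only [detpolMinor, Matrix.submatrix_apply, id]
      rw [sylv_one_apply hfn hm]
      congr 1
      dsimp only
      split_ifs <;> omega
  have hzero : u * f + v * g = 0 := by
    rw [Polynomial.eq_C_of_natDegree_le_zero hconst]
    have : (u * f + v * g).eval s = 0 := by simp [hf, hg]
    rw [Polynomial.eq_C_of_natDegree_le_zero hconst, Polynomial.eval_C] at this
    rw [this, Polynomial.C_0]
  have hzero' : u * p + v * q = 0 := by
    have : (Polynomial.X - Polynomial.C s) * (u * p + v * q) = 0 := by rw [← hzero, hf, hg]; ring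
    exact (mul_eq_zero.1 this).resolve_left (Polynomial.X_sub_C_ne_zero s)
  have hv0 : v = 0 := by
    have hdvd : p ∣ v := hpq.dvd_of_dvd_mul_right ⟨-u, by linear_combination hzero'⟩
    refine Polynomial.eq_zero_of_dvd_of_degree_lt hdvd ?_
    rw [Polynomial.degree_eq_natDegree hp, hv]
    refine lt_of_le_of_lt (Polynomial.degree_sum_le _ _) ?_
    rw [Finset.sup_lt_iff (by exact_mod_cast WithBot.bot_lt_coe _)]
    intro r _
    have := r.isLt
    split_ifs with h
    · rw [Polynomial.degree_zero]; exact WithBot.bot_lt_coe _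
    · refine lt_of_le_of_lt (Polynomial.degree_C_mul_X_pow_le _ _) ?_
      exact_mod_cast (by omega : n - 2 - ((r : ℕ) - (m - 1)) < p.natDegree)
  have hu0 : u = 0 := by
    rw [hv0, zero_mul, add_zero] at hzero'
    exact (mul_eq_zero.1 hzero').resolve_right hp
  refine hw0 (funext fun r => ?_)
  have hr := r.isLt
  by_cases h : (r : ℕ) < m - 1
  · have := congrArg (fun z => Polynomial.coeff z (m - 2 - (r : ℕ))) hu0
    simp only [hu, Polynomial.finsetSum_coeff] at this
    rw [Finset.sum_eq_single r] at this
    · simpa [h] using this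
    · intro r' _ hr'
      have : (r' : ℕ) ≠ r := fun h => hr' (Fin.ext h)
      split_ifs
      · rw [Polynomial.coeff_C_mul_X_pow, if_neg (by omega)]
      · simp
    · simp
  · have := congrArg (fun z => Polynomial.coeff z (n - 2 - ((r : ℕ) - (m - 1)))) hv0
    simp only [hv, Polynomial.finsetSum_coeff] at this
    rw [Finset.sum_eq_single r] at this
    · simpa [h] using this
    · intro r' _ hr'
      have : (r' : ℕ) ≠ r := fun h => hr' (Fin.ext h)
      have := r'.isLt
      split_ifs
      · simp
      · rw [Polynomial.coeff_C_mul_X_pow, if_neg (by omega)]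
    · simp

end Subresultants

noncomputable section

/-! ### Evaluation of polynomials at a point of the plane -/

theorem aeval_aeval_X {E σ : Type*} [CommRing E] [Algebra ℝ E] (p : σ → E) (i : σ) (f : ℝ[X]) :
    MvPolynomial.aeval p (Polynomial.aeval (MvPolynomial.X i : MvPolynomial σ ℝ) f) =
      Polynomial.aeval (p i) f := by
  rw [← Polynomial.aeval_algHom_apply, MvPolynomial.aeval_X]

theorem eval_aeval_X {σ : Type*} (p : σ → ℝ) (i : σ) (f : ℝ[X]) :
    MvPolynomial.eval p (Polynomial.aeval (MvPolynomial.X i : MvPolynomial σ ℝ) f) =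
      f.eval (p i) := by
  have := aeval_aeval_X p i f
  rwa [MvPolynomial.aeval_eq_eval, Polynomial.coe_aeval_eq_eval] at this

/-- Every polynomial function on the curve `α² = H(t)` is of the form `p(t) + q(t) α`. -/
theorem exists_sub_mem_span (H : ℝ[X]) (f : MvPolynomial (Fin 2) ℝ) : ∃ p q : ℝ[X],
    f - (Polynomial.aeval (MvPolynomial.X 0) p + Polynomial.aeval (MvPolynomial.X 0) q *
      MvPolynomial.X 1) ∈ Ideal.span
        {(MvPolynomial.X 1 ^ 2 - Polynomial.aeval (MvPolynomial.X 0) H :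
          MvPolynomial (Fin 2) ℝ)} := by
  induction f using MvPolynomial.induction_on with
  | C c => exact ⟨Polynomial.C c, 0, by simp [MvPolynomial.algebraMap_eq]⟩
  | add f g hf hg =>
    obtain ⟨p, q, h⟩ := hf
    obtain ⟨p', q', h'⟩ := hg
    refine ⟨p + p', q + q', ?_⟩
    have := Ideal.add_mem _ h h'
    convert this using 1
    simp only [map_add]; ring
  | mul_X f i hf =>
    obtain ⟨p, q, h⟩ := hf
    fin_cases i
    · refine ⟨p * Polynomial.X, q * Polynomial.X, ?_⟩
      have := Ideal.mul_mem_right (MvPolynomial.X 0) _ h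
      convert this using 1
      simp only [map_mul, Polynomial.aeval_X, Fin.zero_eta]; ring
    · -- `(p + q α) α = q H + p α` on the curve.
      refine ⟨q * H, p, ?_⟩
      have := Ideal.add_mem _ (Ideal.mul_mem_right (MvPolynomial.X 1) _ h)
        (Ideal.mul_mem_left _ (Polynomial.aeval (MvPolynomial.X 0) q)
          (Ideal.mem_span_singleton_self _))
      convert this using 1
      simp only [map_mul, Fin.mk_one]; ring

/-! ### Fields without square root of `-1` -/

/-- An element of an extension of `ℂ` that is algebraic over `ℝ` is a complex number. -/
theorem exists_complex_of_isAlgebraic {L : Type*} [Field L] [Algebra ℝ L] (j : ℂ →ₐ[ℝ] L) {s : L}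
    (hs : IsAlgebraic ℝ s) : ∃ z, j z = s := by
  let _ : Algebra ℂ L := j.toRingHom.toAlgebra
  have _ : IsScalarTower ℝ ℂ L := IsScalarTower.of_algebraMap_eq fun x => (j.commutes x).symm
  have hi : IsIntegral ℂ s := hs.isIntegral.tower_top
  exact minpoly.mem_range_of_degree_eq_one ℂ s
    (IsAlgClosed.degree_eq_one_of_irreducible ℂ (minpoly.irreducible hi))

/-- The numbers `1` and `i` are linearly independent over a field without square root of `-1`. -/
theorem add_I_mul_eq_zero {K L : Type*} [Field K] [Field L] [Algebra ℝ L] [Algebra K L]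
    (hK : ∀ z : K, z ^ 2 ≠ -1) (j : ℂ →ₐ[ℝ] L) {u v : K}
    (h : algebraMap _ L u + j Complex.I * algebraMap _ L v = 0) : u = 0 ∧ v = 0 := by
  have hI : j Complex.I ^ 2 = -1 := by rw [← map_pow, Complex.I_sq, map_neg, map_one]
  have hv : v = 0 := by
    by_contra hv
    have hv' : algebraMap _ L v ≠ 0 := by simpa using hv
    have e : j Complex.I = algebraMap K L (-(u / v)) := by
      rw [map_neg, map_div₀]
      field_simp
      linear_combination h
    rw [e, ← map_pow, ← map_one (algebraMap K L), ← map_neg] at hI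
    exact hK _ ((algebraMap _ L).injective hI)
  subst hv
  exact ⟨by simpa using h, rfl⟩

/-- In a field without square root of `-1`, the elements that are algebraic over `ℝ` are real. -/
theorem exists_eq_algebraMap_of_isAlgebraic {K : Type*} [Field K] [Algebra ℝ K]
    (hK : ∀ z : K, z ^ 2 ≠ -1) {z : K} (hz : IsAlgebraic ℝ z) :
    ∃ c : ℝ, z = algebraMap ℝ _ c := by
  let j : ℂ →ₐ[ℝ] AlgebraicClosure K := IsAlgClosed.lift
  obtain ⟨w, hw⟩ := exists_complex_of_isAlgebraic j
    (hz.algebraMap (A := AlgebraicClosure K))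
  have hw' : w = algebraMap ℝ ℂ w.re + Complex.I * algebraMap ℝ ℂ w.im := by
    rw [mul_comm]; exact (Complex.re_add_im w).symm
  rw [hw', map_add, map_mul, AlgHom.commutes, AlgHom.commutes,
    IsScalarTower.algebraMap_apply ℝ K (AlgebraicClosure K),
    IsScalarTower.algebraMap_apply ℝ K (AlgebraicClosure K)] at hw
  refine ⟨w.re, ?_⟩
  have := (add_I_mul_eq_zero hK j (u := algebraMap ℝ _ w.re - z) (v := algebraMap ℝ _ w.im)
    (by rw [map_sub, ← hw]; ring)).1
  exact (sub_eq_zero.1 this).symm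

/-! ### The polynomials `Û` and `V̂` -/

/-- The greatest common divisor of `U` and `V`. -/
def gcdUV (X Y W : ℝ[X]) : ℝ[X] := EuclideanDomain.gcd (polyU X W) (polyV Y W)

/-- The polynomial `Û² + V̂²`. -/
def sumSq (X Y W : ℝ[X]) : ℝ[X] := hatU X Y W ^ 2 + hatV X Y W ^ 2

theorem auxPoly_eq (X Y W : ℝ[X]) : auxPoly X Y W =
    MvPolynomial.X 1 ^ 2 - Polynomial.aeval (MvPolynomial.X 0) (sumSq X Y W) := by
  simp [auxPoly, sumSq]

theorem mem_auxCurve_iff (X Y W : ℝ[X]) (q : Fin 2 → ℝ) :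
    q ∈ auxCurve X Y W ↔ q 1 ^ 2 = (sumSq X Y W).eval (q 0) := by
  simp [auxCurve, auxPoly_eq, eval_aeval_X, sub_eq_zero]

theorem gcdUV_mul_hatU (X Y W : ℝ[X]) : gcdUV X Y W * hatU X Y W = polyU X W := by
  rcases eq_or_ne (gcdUV X Y W) 0 with h | h
  · rw [h, zero_mul, (EuclideanDomain.gcd_eq_zero_iff.1 h).1]
  · exact EuclideanDomain.mul_div_cancel' h (EuclideanDomain.gcd_dvd_left _ _)

theorem gcdUV_mul_hatV (X Y W : ℝ[X]) : gcdUV X Y W * hatV X Y W = polyV Y W := by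
  rcases eq_or_ne (gcdUV X Y W) 0 with h | h
  · rw [h, zero_mul, (EuclideanDomain.gcd_eq_zero_iff.1 h).2]
  · exact EuclideanDomain.mul_div_cancel' h (EuclideanDomain.gcd_dvd_right _ _)

/-- If `U = V = 0`, the equation of the auxiliary curve would be `α² = 0`. -/
theorem gcdUV_ne_zero (X Y W : ℝ[X]) [hM : Fact (Irreducible (auxPoly X Y W))] :
    gcdUV X Y W ≠ 0 := by
  intro h
  have h1 : hatU X Y W = 0 := by unfold hatU; rw [← gcdUV, h, EuclideanDomain.div_zero]
  have h2 : hatV X Y W = 0 := by unfold hatV; rw [← gcdUV, h, EuclideanDomain.div_zero]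
  have := hM.out
  rw [auxPoly, h1, h2] at this
  simp only [map_zero, ne_eq, OfNat.ofNat_ne_zero, not_false_eq_true, zero_pow, add_zero,
    sub_zero] at this
  exact not_irreducible_pow (by norm_num) this

variable (X Y W : ℝ[X]) [hM : Fact (Irreducible (auxPoly X Y W))]

theorem isCoprime_hatU_hatV : IsCoprime (hatU X Y W) (hatV X Y W) := by
  have h := EuclideanDomain.gcd_eq_gcd_ab (polyU X W) (polyV Y W)
  rw [← gcdUV] at h
  refine ⟨EuclideanDomain.gcdA (polyU X W) (polyV Y W),
    EuclideanDomain.gcdB (polyU X W) (polyV Y W), mul_left_cancel₀ (gcdUV_ne_zero X Y W) ?_⟩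
  conv_rhs => rw [mul_one, h]
  rw [← gcdUV_mul_hatU X Y W, ← gcdUV_mul_hatV X Y W]
  ring

theorem sumSq_eval_pos (t : ℝ) : 0 < (sumSq X Y W).eval t := by
  obtain ⟨a, b, h⟩ := isCoprime_hatU_hatV X Y W
  have h := congrArg (Polynomial.eval t) h
  simp only [Polynomial.eval_add, Polynomial.eval_mul, Polynomial.eval_one] at h
  simp only [sumSq, Polynomial.eval_add, Polynomial.eval_pow]
  by_contra hle
  have h1 : (hatU X Y W).eval t = 0 := by
    nlinarith [sq_nonneg ((hatU X Y W).eval t), sq_nonneg ((hatV X Y W).eval t)]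
  have h2 : (hatV X Y W).eval t = 0 := by
    nlinarith [sq_nonneg ((hatU X Y W).eval t), sq_nonneg ((hatV X Y W).eval t)]
  rw [h1, h2] at h
  simp at h

theorem sumSq_ne_zero : sumSq X Y W ≠ 0 := fun h => by
  simpa [h] using sumSq_eval_pos X Y W 0

/-! ### The function field of the auxiliary curve -/

/-- A function `p(t) + q(t) α` that vanishes at all real points of the auxiliary curve is zero,
because over every real `t` there are two points of the curve, with opposite `α ≠ 0`. -/
theorem eq_zero_of_eval_add_mul {p q : ℝ[X]}
    (key : ∀ t β : ℝ, β ^ 2 = (sumSq X Y W).eval t → p.eval t + q.eval t * β = 0) :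
    p = 0 ∧ q = 0 := by
  have hpq : ∀ t, p.eval t = 0 ∧ q.eval t = 0 := by
    intro t
    have hpos := sumSq_eval_pos X Y W t
    have h1 := key t _ (Real.sq_sqrt hpos.le)
    have h2 := key t (-√((sumSq X Y W).eval t)) (by rw [neg_sq, Real.sq_sqrt hpos.le])
    have h3 : q.eval t * √((sumSq X Y W).eval t) = 0 := by linarith
    exact ⟨by linarith, (mul_eq_zero.1 h3).resolve_right (Real.sqrt_pos.2 hpos).ne'⟩
  exact ⟨Polynomial.funext fun t => by simpa using (hpq t).1,
    Polynomial.funext fun t => by simpa using (hpq t).2⟩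

/-- The real points are Zariski dense in the auxiliary curve. -/
theorem mem_auxIdeal_iff (f : MvPolynomial (Fin 2) ℝ) :
    f ∈ auxIdeal X Y W ↔ ∀ q ∈ auxCurve X Y W, MvPolynomial.eval q f = 0 := by
  constructor
  · intro hf q hq
    obtain ⟨g, rfl⟩ := Ideal.mem_span_singleton.1 hf
    rw [map_mul, hq, zero_mul]
  · intro hf
    obtain ⟨p, q, h⟩ := exists_sub_mem_span (sumSq X Y W) f
    rw [← auxPoly_eq] at h
    have key : ∀ t β : ℝ, β ^ 2 = (sumSq X Y W).eval t → p.eval t + q.eval t * β = 0 := by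
      intro t β hβ
      have hm : ![t, β] ∈ auxCurve X Y W := by simpa [mem_auxCurve_iff] using hβ
      obtain ⟨g, hg⟩ := Ideal.mem_span_singleton.1 h
      have := congrArg (MvPolynomial.eval ![t, β]) hg
      rw [map_mul, hm, zero_mul, map_sub, hf _ hm] at this
      simp only [map_add, map_mul, eval_aeval_X, MvPolynomial.eval_X, Matrix.cons_val_zero,
        Matrix.cons_val_one] at this
      linarith
    obtain ⟨hp, hq⟩ := eq_zero_of_eval_add_mul X Y W key
    rw [hp, hq, map_zero, zero_mul, add_zero, sub_zero] at h
    exact h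

/-- The function field `ℝ(M)` of the auxiliary curve, as a type of its own that carries only the
structure of a field extension of `ℝ`. -/
def AuxField : Type := FunField (auxIdeal X Y W)

instance : Field (AuxField X Y W) := inferInstanceAs (Field (FunField (auxIdeal X Y W)))

instance : Algebra ℝ (AuxField X Y W) :=
  inferInstanceAs (Algebra ℝ (FunField (auxIdeal X Y W)))

instance : CharZero (AuxField X Y W) :=
  charZero_of_injective_algebraMap (algebraMap ℝ (AuxField X Y W)).injective

/-- The coordinate function `t` on the auxiliary curve. -/
def auxT : AuxField X Y W := ratFun (auxIdeal X Y W) (MvPolynomial.X 0)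

/-- The coordinate function `α` on the auxiliary curve. -/
def auxA : AuxField X Y W := ratFun (auxIdeal X Y W) (MvPolynomial.X 1)

theorem ratFun_eq_aeval (I : Ideal (MvPolynomial (Fin 2) ℝ)) (f : MvPolynomial (Fin 2) ℝ) :
    ratFun I f = MvPolynomial.aeval
      ![ratFun I (MvPolynomial.X 0), ratFun I (MvPolynomial.X 1)] f := by
  have h := MvPolynomial.aeval_unique ((IsScalarTower.toAlgHom ℝ (MvPolynomial (Fin 2) ℝ ⧸ I)
    (FunField I)).comp (Ideal.Quotient.mkₐ ℝ I))
  have h' := DFunLike.congr_fun h f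
  have e : (fun i => ((IsScalarTower.toAlgHom ℝ (MvPolynomial (Fin 2) ℝ ⧸ I)
    (FunField I)).comp (Ideal.Quotient.mkₐ ℝ I)) (MvPolynomial.X i)) =
    ![ratFun I (MvPolynomial.X 0), ratFun I (MvPolynomial.X 1)] := by
    funext i; fin_cases i <;> rfl
  rw [← e]
  exact h'

theorem ratFun_auxIdeal_eq (f : MvPolynomial (Fin 2) ℝ) :
    ratFun (auxIdeal X Y W) f = MvPolynomial.aeval ![auxT X Y W, auxA X Y W] f :=
  ratFun_eq_aeval _ f

theorem auxFun_eq (f : ℝ[X]) : auxFun X Y W f = Polynomial.aeval (auxT X Y W) f := by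
  rw [auxFun, ratFun_auxIdeal_eq, aeval_aeval_X]; rfl

theorem ratFun_eq_zero_iff (I : Ideal (MvPolynomial (Fin 2) ℝ)) [I.IsPrime]
    (f : MvPolynomial (Fin 2) ℝ) : ratFun I f = 0 ↔ f ∈ I := by
  rw [ratFun, map_eq_zero_iff _ (IsFractionRing.injective _ _), Ideal.Quotient.eq_zero_iff_mem]

theorem aeval_aux_eq_zero_iff (f : MvPolynomial (Fin 2) ℝ) :
    MvPolynomial.aeval ![auxT X Y W, auxA X Y W] f = 0 ↔
      ∀ q ∈ auxCurve X Y W, MvPolynomial.eval q f = 0 := by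
  rw [← ratFun_auxIdeal_eq]
  exact (ratFun_eq_zero_iff _ f).trans (mem_auxIdeal_iff X Y W f)

theorem exists_eq_div (z : AuxField X Y W) : ∃ f g : MvPolynomial (Fin 2) ℝ,
    MvPolynomial.aeval ![auxT X Y W, auxA X Y W] g ≠ 0 ∧
      z = MvPolynomial.aeval ![auxT X Y W, auxA X Y W] f /
        MvPolynomial.aeval ![auxT X Y W, auxA X Y W] g := by
  obtain ⟨x, y, hy, rfl⟩ := IsFractionRing.div_surjective (A := MvPolynomial (Fin 2) ℝ ⧸
    auxIdeal X Y W) (K := FunField (auxIdeal X Y W)) z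
  obtain ⟨f, rfl⟩ := Ideal.Quotient.mk_surjective x
  obtain ⟨g, rfl⟩ := Ideal.Quotient.mk_surjective y
  refine ⟨f, g, ?_, ?_⟩
  · rw [← ratFun_auxIdeal_eq]
    exact IsFractionRing.to_map_ne_zero_of_mem_nonZeroDivisors
      (K := FunField (auxIdeal X Y W)) hy
  · simp only [← ratFun_auxIdeal_eq]; rfl

theorem auxA_sq : auxA X Y W ^ 2 = Polynomial.aeval (auxT X Y W) (sumSq X Y W) := by
  have := (aeval_aux_eq_zero_iff X Y W (auxPoly X Y W)).2 fun q hq => hq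
  simpa [auxPoly_eq, aeval_aeval_X, sub_eq_zero] using this

/-- The functions `1` and `α` are linearly independent over `ℝ(t)`. -/
theorem aeval_add_mul_auxA_eq_zero {p q : ℝ[X]}
    (h : Polynomial.aeval (auxT X Y W) p + Polynomial.aeval (auxT X Y W) q * auxA X Y W = 0) :
    p = 0 ∧ q = 0 := by
  have key : ∀ t β : ℝ, β ^ 2 = (sumSq X Y W).eval t → p.eval t + q.eval t * β = 0 := by
    intro t β hβ
    have := (aeval_aux_eq_zero_iff X Y W (Polynomial.aeval (MvPolynomial.X 0) p +
      Polynomial.aeval (MvPolynomial.X 0) q * MvPolynomial.X 1)).1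
      (by simpa [aeval_aeval_X] using h) ![t, β] (by simpa [mem_auxCurve_iff] using hβ)
    simpa [eval_aeval_X] using this
  exact eq_zero_of_eval_add_mul X Y W key

theorem aeval_auxT_eq_zero_iff {p : ℝ[X]} : Polynomial.aeval (auxT X Y W) p = 0 ↔ p = 0 :=
  ⟨fun h => (aeval_add_mul_auxA_eq_zero X Y W (p := p) (q := 0) (by simp [h])).1,
    fun h => by simp [h]⟩

theorem auxA_ne_zero : auxA X Y W ≠ 0 := by
  intro h
  have := auxA_sq X Y W
  rw [h, zero_pow two_ne_zero, eq_comm, aeval_auxT_eq_zero_iff] at this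
  exact sumSq_ne_zero X Y W this

/-- As the auxiliary curve is irreducible, `Û² + V̂²` is not a square. -/
theorem sumSq_ne_sq (h : ℝ[X]) : sumSq X Y W ≠ h ^ 2 := by
  intro hh
  have h1 := auxA_sq X Y W
  rw [hh, map_pow] at h1
  rcases sq_eq_sq_iff_eq_or_eq_neg.1 h1 with h2 | h2
  · have := (aeval_add_mul_auxA_eq_zero X Y W (p := -h) (q := 1) (by simp [h2])).2
    exact one_ne_zero this
  · have := (aeval_add_mul_auxA_eq_zero X Y W (p := h) (q := 1) (by simp [h2])).2
    exact one_ne_zero this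

/-- The polynomials `Û` and `V̂` are not proportional, for otherwise `Û² + V̂²` would be a
square. -/
theorem hat_linearIndependent {c₁ c₂ : ℝ}
    (h : Polynomial.C c₁ * hatU X Y W + Polynomial.C c₂ * hatV X Y W = 0) : c₁ = 0 ∧ c₂ = 0 := by
  have key : ∀ (c₁ c₂ : ℝ) (u v : ℝ[X]), sumSq X Y W = u ^ 2 + v ^ 2 →
      Polynomial.C c₁ * u + Polynomial.C c₂ * v = 0 → c₁ = 0 := by
    intro c₁ c₂ u v hs h
    by_contra hc
    have hu : u = Polynomial.C (-(c₂ / c₁)) * v := by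
      have e : Polynomial.C c₁⁻¹ * Polynomial.C c₁ = 1 := by
        rw [← Polynomial.C_mul, inv_mul_cancel₀ hc, Polynomial.C_1]
      rw [div_eq_mul_inv, Polynomial.C_neg, Polynomial.C_mul]
      linear_combination Polynomial.C c₁⁻¹ * h - u * e
    refine sumSq_ne_sq X Y W (Polynomial.C (√((c₂ / c₁) ^ 2 + 1)) * v) ?_
    rw [hs, hu, mul_pow, mul_pow, ← Polynomial.C_pow, ← Polynomial.C_pow,
      Real.sq_sqrt (by positivity)]
    simp only [neg_sq, Polynomial.C_add, Polynomial.C_1]; ring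
  exact ⟨key c₁ c₂ _ _ rfl h, key c₂ c₁ (hatV X Y W) (hatU X Y W) (by rw [sumSq, add_comm])
    (by rw [add_comm]; exact h)⟩

theorem hatV_ne_zero : hatV X Y W ≠ 0 := fun h =>
  one_ne_zero (hat_linearIndependent X Y W (c₁ := 0) (c₂ := 1) (by simp [h])).2

/-- The function field of the auxiliary curve is formally real, because the real points are
dense. -/
theorem sq_ne_neg_one (z : AuxField X Y W) : z ^ 2 ≠ -1 := by
  obtain ⟨f, g, hg, rfl⟩ := exists_eq_div X Y W z
  intro h
  rw [div_pow, div_eq_iff (pow_ne_zero 2 hg)] at h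
  refine hg ((aeval_aux_eq_zero_iff X Y W g).2 fun q hq => ?_)
  have := (aeval_aux_eq_zero_iff X Y W (f ^ 2 + g ^ 2)).1
    (by rw [map_add, map_pow, map_pow, h]; ring) q hq
  simp only [map_add, map_pow] at this
  nlinarith [sq_nonneg (MvPolynomial.eval q f), sq_nonneg (MvPolynomial.eval q g)]

/-- The function field of the auxiliary curve has transcendence degree `1`, so that any two
functions on it satisfy an algebraic relation. -/
theorem not_algebraicIndependent (a b : AuxField X Y W) : ¬ AlgebraicIndependent ℝ ![a, b] := by
  set A := Algebra.adjoin ℝ {auxT X Y W}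
  have hpoly : ∀ p : ℝ[X], Polynomial.aeval (auxT X Y W) p ∈ A := fun p =>
    Polynomial.aeval_mem_adjoin_singleton ℝ _
  have hα : IsAlgebraic A (auxA X Y W) := by
    refine ⟨Polynomial.X ^ 2 - Polynomial.C ⟨_, hpoly (sumSq X Y W)⟩,
      Polynomial.X_pow_sub_C_ne_zero (by norm_num) _, ?_⟩
    simp [auxA_sq]
  have ht : IsAlgebraic A (auxT X Y W) :=
    isAlgebraic_algebraMap (A := AuxField X Y W)
      (⟨auxT X Y W, Algebra.self_mem_adjoin_singleton ℝ _⟩ : A)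
  have hf : ∀ f : MvPolynomial (Fin 2) ℝ,
      IsAlgebraic A (MvPolynomial.aeval ![auxT X Y W, auxA X Y W] f) := by
    intro f
    induction f using MvPolynomial.induction_on with
    | C c =>
      rw [MvPolynomial.aeval_C, IsScalarTower.algebraMap_apply ℝ A]
      exact isAlgebraic_algebraMap _
    | add f g hf hg => rw [map_add]; exact hf.add hg
    | mul_X f i hf =>
      rw [map_mul, MvPolynomial.aeval_X]
      refine hf.mul ?_
      fin_cases i
      · exact ht
      · exact hα
  have : Algebra.IsAlgebraic A (AuxField X Y W) := by
    refine ⟨fun z => ?_⟩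
    obtain ⟨f, g, -, rfl⟩ := exists_eq_div X Y W z
    rw [div_eq_mul_inv]
    exact (hf f).mul (hf g).inv
  intro h
  have h1 := h.cardinalMk_le_trdeg
  have h2 := h1.trans (Algebra.IsAlgebraic.trdeg_le_cardinalMk ℝ {auxT X Y W})
  simp at h2

end

noncomputable section

/-! ### Homomorphisms and derivations of the function field -/

variable (X Y W : ℝ[X]) [hM : Fact (Irreducible (auxPoly X Y W))]

/-- A ring homomorphism out of `ℝ[t, α]` that kills the equation of the auxiliary curve and
maps the nonzero functions to units extends to the function field. -/
theorem exists_algHom_of_isUnit {E : Type} [CommRing E] [Algebra ℝ E] {s β : E}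
    (hβ : β ^ 2 = Polynomial.aeval s (sumSq X Y W))
    (hu : ∀ f : MvPolynomial (Fin 2) ℝ, MvPolynomial.aeval ![auxT X Y W, auxA X Y W] f ≠ 0 →
      IsUnit (MvPolynomial.aeval ![s, β] f)) :
    ∃ ρ : AuxField X Y W →ₐ[ℝ] E, ρ (auxT X Y W) = s ∧ ρ (auxA X Y W) = β := by
  let g : (MvPolynomial (Fin 2) ℝ ⧸ auxIdeal X Y W) →ₐ[ℝ] E :=
    Ideal.Quotient.liftₐ (auxIdeal X Y W) (MvPolynomial.aeval ![s, β]) (by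
      intro f hf
      obtain ⟨h, rfl⟩ := Ideal.mem_span_singleton.1 hf
      rw [map_mul, auxPoly_eq]
      simp [aeval_aeval_X, hβ])
  have hg : ∀ y : nonZeroDivisors (MvPolynomial (Fin 2) ℝ ⧸ auxIdeal X Y W), IsUnit (g y) := by
    rintro ⟨y, hy⟩
    obtain ⟨f, rfl⟩ := Ideal.Quotient.mk_surjective y
    refine hu f ?_
    rw [← ratFun_auxIdeal_eq]
    exact IsFractionRing.to_map_ne_zero_of_mem_nonZeroDivisors
      (K := FunField (auxIdeal X Y W)) hy
  obtain ⟨ρ, hρ⟩ : ∃ ρ : FunField (auxIdeal X Y W) →ₐ[ℝ] E, ∀ f, ρ (algebraMap _ _ f) = g f :=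
    ⟨IsLocalization.liftAlgHom hg, fun f => IsLocalization.lift_eq (g := g.toRingHom) hg f⟩
  exact ⟨ρ, (hρ _).trans (MvPolynomial.aeval_X _ _), (hρ _).trans (MvPolynomial.aeval_X _ _)⟩

/-- A point `(s, β)` of the auxiliary curve with `s` transcendental over `ℝ` is generic. -/
theorem exists_algHom_of_transcendental {E : Type} [Field E] [Algebra ℝ E] {s β : E}
    (hs : Transcendental ℝ s) (hβ : β ^ 2 = Polynomial.aeval s (sumSq X Y W)) :
    ∃ ρ : AuxField X Y W →ₐ[ℝ] E, ρ (auxT X Y W) = s ∧ ρ (auxA X Y W) = β := by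
  refine exists_algHom_of_isUnit X Y W hβ fun f hf => ?_
  rw [isUnit_iff_ne_zero]
  contrapose! hf
  obtain ⟨p, q, h⟩ := exists_sub_mem_span (sumSq X Y W) f
  obtain ⟨g, hg⟩ := Ideal.mem_span_singleton.1 h
  have e1 := congrArg (MvPolynomial.aeval ![s, β]) hg
  have e2 := congrArg (MvPolynomial.aeval ![auxT X Y W, auxA X Y W]) hg
  simp only [map_sub, map_add, map_mul, map_pow, aeval_aeval_X, MvPolynomial.aeval_X,
    Matrix.cons_val_zero, Matrix.cons_val_one, auxA_sq, hβ, sub_self, zero_mul, hf] at e1 e2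
  -- The norm of `p + q α` vanishes at `s`, hence identically.
  have e3 : Polynomial.aeval s (p ^ 2 - q ^ 2 * sumSq X Y W) = 0 := by
    simp only [map_sub, map_mul, map_pow, ← hβ]
    linear_combination -(Polynomial.aeval s p - Polynomial.aeval s q * β) * e1
  have e4 : p ^ 2 - q ^ 2 * sumSq X Y W = 0 := (transcendental_iff.1 hs) _ e3
  have e5 := congrArg (Polynomial.aeval (auxT X Y W)) e4
  simp only [map_sub, map_mul, map_pow, ← auxA_sq, map_zero] at e5
  have e6 : (Polynomial.aeval (auxT X Y W) p + Polynomial.aeval (auxT X Y W) q * auxA X Y W) *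
      (Polynomial.aeval (auxT X Y W) p + Polynomial.aeval (auxT X Y W) (-q) * auxA X Y W) = 0 := by
    rw [map_neg]; linear_combination e5
  have e7 : p = 0 ∧ q = 0 := by
    rcases mul_eq_zero.1 e6 with e | e
    · exact aeval_add_mul_auxA_eq_zero X Y W e
    · simpa using aeval_add_mul_auxA_eq_zero X Y W e
  rw [e7.1, e7.2] at e2
  simpa using e2

theorem transcendental_auxT : Transcendental ℝ (auxT X Y W) :=
  transcendental_iff.2 fun _ hp => (aeval_auxT_eq_zero_iff X Y W).1 hp

variable {X Y W} in
theorem algHom_ext_aux {E : Type*} [Field E] [Algebra ℝ E] {ρ σ : AuxField X Y W →ₐ[ℝ] E}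
    (ht : ρ (auxT X Y W) = σ (auxT X Y W)) (hα : ρ (auxA X Y W) = σ (auxA X Y W)) : ρ = σ := by
  have h : ρ.comp (MvPolynomial.aeval ![auxT X Y W, auxA X Y W]) =
      σ.comp (MvPolynomial.aeval ![auxT X Y W, auxA X Y W]) := by
    refine MvPolynomial.algHom_ext fun i => ?_
    fin_cases i <;> simpa
  refine AlgHom.ext fun z => ?_
  obtain ⟨f, g, -, rfl⟩ := exists_eq_div X Y W z
  have h1 := DFunLike.congr_fun h f
  have h2 := DFunLike.congr_fun h g
  simp only [AlgHom.comp_apply] at h1 h2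
  rw [map_div₀, map_div₀, h1, h2]

/-- The derivation `d/dt` of the function field of the auxiliary curve. It is the infinitesimal part
of the homomorphism to the dual numbers that sends `t` to `t + ε`. -/
theorem exists_derivation : ∃ D : Derivation ℝ (AuxField X Y W) (AuxField X Y W),
    D (auxT X Y W) = 1 := by
  have hα := auxA_ne_zero X Y W
  -- The derivative of `α`, from `2 α dα = (Û² + V̂²)' dt`.
  set η : AuxField X Y W := Polynomial.aeval (auxT X Y W) (Polynomial.derivative (sumSq X Y W)) /
    (2 * auxA X Y W) with hη
  have hfst : ∀ f : MvPolynomial (Fin 2) ℝ, TrivSqZeroExt.fst (MvPolynomial.aeval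
      ![(TrivSqZeroExt.inl (auxT X Y W) + TrivSqZeroExt.inr 1 :
          TrivSqZeroExt (AuxField X Y W) (AuxField X Y W)),
        TrivSqZeroExt.inl (auxA X Y W) + TrivSqZeroExt.inr η] f) =
      MvPolynomial.aeval ![auxT X Y W, auxA X Y W] f := by
    intro f
    have : (TrivSqZeroExt.fstHom ℝ (AuxField X Y W) (AuxField X Y W)).comp
        (MvPolynomial.aeval ![(TrivSqZeroExt.inl (auxT X Y W) + TrivSqZeroExt.inr 1),
          TrivSqZeroExt.inl (auxA X Y W) + TrivSqZeroExt.inr η]) =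
        MvPolynomial.aeval ![auxT X Y W, auxA X Y W] := by
      refine MvPolynomial.algHom_ext fun i => ?_
      fin_cases i <;> simp
    exact DFunLike.congr_fun this f
  obtain ⟨Δ, hΔt, hΔα⟩ := exists_algHom_of_isUnit X Y W
    (E := TrivSqZeroExt (AuxField X Y W) (AuxField X Y W))
    (s := TrivSqZeroExt.inl (auxT X Y W) + TrivSqZeroExt.inr 1)
    (β := TrivSqZeroExt.inl (auxA X Y W) + TrivSqZeroExt.inr η) (by
      rw [Polynomial.aeval_add_of_sq_eq_zero _ _ _ (by rw [sq, TrivSqZeroExt.inr_mul_inr])]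
      have hin : ∀ p : ℝ[X], Polynomial.aeval (TrivSqZeroExt.inl (auxT X Y W) :
          TrivSqZeroExt (AuxField X Y W) (AuxField X Y W)) p =
            TrivSqZeroExt.inl (Polynomial.aeval (auxT X Y W) p) := fun p =>
        Polynomial.aeval_algHom_apply
          (TrivSqZeroExt.inlAlgHom ℝ (AuxField X Y W) (AuxField X Y W)) (auxT X Y W) p
      rw [hin, hin, ← auxA_sq]
      ext
      · simp
      · simp [sq, hη]
        field_simp
        ring)
    (fun f hf => by
      rw [TrivSqZeroExt.isUnit_iff_isUnit_fst, hfst]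
      exact hf.isUnit)
  have hid : (TrivSqZeroExt.fstHom ℝ (AuxField X Y W) (AuxField X Y W)).comp Δ =
      AlgHom.id ℝ (AuxField X Y W) :=
    algHom_ext_aux (by rw [AlgHom.comp_apply, hΔt]; simp)
      (by rw [AlgHom.comp_apply, hΔα]; simp)
  have hid' : ∀ z, (Δ z).fst = z := fun z => DFunLike.congr_fun hid z
  refine ⟨Derivation.mk' ((TrivSqZeroExt.sndHom (AuxField X Y W)
    (AuxField X Y W)).restrictScalars ℝ ∘ₗ Δ.toLinearMap) ?_, ?_⟩
  · intro a b
    simp [hid', mul_comm]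
  · simp [hΔt]

theorem derivation_aeval_pair {K : Type*} [Field K] [Algebra ℝ K] (D : Derivation ℝ K K)
    (a b : K) (F : MvPolynomial (Fin 2) ℝ) :
    D (MvPolynomial.aeval ![a, b] F) =
      MvPolynomial.aeval ![a, b] (MvPolynomial.pderiv 0 F) * D a +
        MvPolynomial.aeval ![a, b] (MvPolynomial.pderiv 1 F) * D b := by
  induction F using MvPolynomial.induction_on with
  | C c => simp
  | add f g hf hg => simp only [map_add, hf, hg]; ring
  | mul_X f i hf =>
    fin_cases i <;>
    · simp [Derivation.leibniz, hf, MvPolynomial.pderiv_X]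
      ring

theorem totalDegree_pderiv_lt {σ : Type*} (i : σ) {F : MvPolynomial σ ℝ}
    (h : MvPolynomial.pderiv i F ≠ 0) : (MvPolynomial.pderiv i F).totalDegree < F.totalDegree := by
  obtain ⟨m, hm, hd⟩ := Finset.exists_mem_eq_sup _ (MvPolynomial.support_nonempty.2 h)
    fun s : σ →₀ ℕ => s.sum fun _ e => e
  rw [MvPolynomial.totalDegree, hd]
  rw [MvPolynomial.mem_support_iff, MvPolynomial.coeff_pderiv] at hm
  have := MvPolynomial.le_totalDegree (MvPolynomial.mem_support_iff.2 (left_ne_zero_of_mul hm))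
  rw [Finsupp.sum_add_index' (fun _ => rfl) (fun _ _ _ => rfl), Finsupp.sum_single_index rfl]
    at this
  omega

theorem eq_C_of_pderiv_eq_zero {σ : Type*} {F : MvPolynomial σ ℝ}
    (h : ∀ i, MvPolynomial.pderiv i F = 0) : ∃ c, F = MvPolynomial.C c := by
  classical
  refine ⟨F.coeff 0, MvPolynomial.ext _ _ fun m => ?_⟩
  rw [MvPolynomial.coeff_C]
  split_ifs with hm
  · rw [hm]
  · obtain ⟨i, hi⟩ : ∃ i, m i ≠ 0 := by
      by_contra! h0
      exact hm (Finsupp.ext fun i => (h0 i).symm)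
    have := congrArg (MvPolynomial.coeff (m - Finsupp.single i 1)) (h i)
    have hle : Finsupp.single i 1 ≤ m := Finsupp.single_le_iff.2 (Nat.one_le_iff_ne_zero.2 hi)
    rw [MvPolynomial.coeff_pderiv, tsub_add_cancel_of_le hle, MvPolynomial.coeff_zero] at this
    exact (mul_eq_zero.1 this).resolve_right (by positivity)

/-- The differentials of two elements `a`, `b` that are algebraically dependent over `ℝ` satisfy a
linear relation with coefficients in `ℝ[a, b]`: differentiate an equation of least degree. -/
theorem exists_linear_relation {K : Type*} [Field K] [Algebra ℝ K] (D : Derivation ℝ K K) {a b : K}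
    (hab : ¬ AlgebraicIndependent ℝ ![a, b]) : ∃ F₁ F₂ : MvPolynomial (Fin 2) ℝ,
      MvPolynomial.aeval ![a, b] F₁ * D a + MvPolynomial.aeval ![a, b] F₂ * D b = 0 ∧
      (MvPolynomial.aeval ![a, b] F₁ ≠ 0 ∨ MvPolynomial.aeval ![a, b] F₂ ≠ 0) := by
  have hex : ∃ n, ∃ F : MvPolynomial (Fin 2) ℝ, F ≠ 0 ∧ MvPolynomial.aeval ![a, b] F = 0 ∧
      F.totalDegree = n := by
    rw [algebraicIndependent_iff] at hab
    push Not at hab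
    obtain ⟨F, h1, h2⟩ := hab
    exact ⟨_, F, h2, h1, rfl⟩
  classical
  obtain ⟨F, hF0, hF, hdeg⟩ := Nat.find_spec hex
  have hmin : ∀ i, MvPolynomial.pderiv i F ≠ 0 →
      MvPolynomial.aeval ![a, b] (MvPolynomial.pderiv i F) ≠ 0 := fun i hi h =>
    Nat.find_min hex (hdeg ▸ totalDegree_pderiv_lt i hi) ⟨_, hi, h, rfl⟩
  refine ⟨MvPolynomial.pderiv 0 F, MvPolynomial.pderiv 1 F, ?_, ?_⟩
  · rw [← derivation_aeval_pair, hF, map_zero]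
  · by_contra! h
    obtain ⟨c, hc⟩ := eq_C_of_pderiv_eq_zero (F := F) fun i => by
      fin_cases i
      · exact not_not.1 fun h0 => hmin 0 h0 h.1
      · exact not_not.1 fun h0 => hmin 1 h0 h.2
    rw [hc, MvPolynomial.aeval_C] at hF
    rw [(algebraMap ℝ K).injective (hF.trans (map_zero _).symm), map_zero] at hc
    exact hF0 hc

/-- If `u` is transcendental over `ℝ` and `u`, `x` are algebraically dependent, then no
homomorphism fixes `u` and sends `x` to `x + c u` with `c ≠ 0`: an equation of `x` over `ℝ[u]`
would have the infinitely many roots `x + k c u`. -/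
theorem algHom_ne_translation {K L : Type*} [Field K] [Field L] [Algebra ℝ K] [Algebra ℝ L]
    (ι θ : K →ₐ[ℝ] L) {u x : K} (hu : Transcendental ℝ u)
    (hux : ¬ AlgebraicIndependent ℝ ![x, u]) (hθu : θ u = ι u) {c : ℝ} (hc : c ≠ 0) :
    θ x ≠ ι (x + algebraMap ℝ K c * u) := by
  intro hθx
  rw [algebraicIndependent_iff] at hux
  push Not at hux
  obtain ⟨F, hF, hF0⟩ := hux
  have hu0 : u ≠ 0 := fun h => hu (h ▸ isAlgebraic_zero)
  have hshift : ∀ G : MvPolynomial (Fin 2) ℝ, MvPolynomial.aeval ![x, u] G = 0 →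
      MvPolynomial.aeval ![x + algebraMap ℝ K c * u, u] G = 0 := by
    intro G hG
    have e1 : θ.comp (MvPolynomial.aeval ![x, u]) =
        ι.comp (MvPolynomial.aeval ![x + algebraMap ℝ K c * u, u]) := by
      refine MvPolynomial.algHom_ext fun i => ?_
      fin_cases i
      · simpa using hθx
      · simpa using hθu
    have e2 := DFunLike.congr_fun e1 G
    rw [AlgHom.comp_apply, AlgHom.comp_apply, hG, map_zero] at e2
    exact (map_eq_zero ι).1 e2.symm
  have key : ∀ (k : ℕ) (G : MvPolynomial (Fin 2) ℝ), MvPolynomial.aeval ![x, u] G = 0 →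
      MvPolynomial.aeval ![x + k * (algebraMap ℝ K c * u), u] G = 0 := by
    intro k
    induction k with
    | zero => intro G hG; simpa using hG
    | succ k ih =>
      intro G hG
      let τ : MvPolynomial (Fin 2) ℝ →ₐ[ℝ] MvPolynomial (Fin 2) ℝ := MvPolynomial.aeval
        ![MvPolynomial.X 0 + MvPolynomial.C c * MvPolynomial.X 1, MvPolynomial.X 1]
      have hτ : ∀ v, MvPolynomial.aeval ![v, u] (τ G) =
          MvPolynomial.aeval ![v + algebraMap ℝ K c * u, u] G := by
        intro v
        have : (MvPolynomial.aeval ![v, u]).comp τ =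
            (MvPolynomial.aeval ![v + algebraMap ℝ K c * u, u] :
              MvPolynomial (Fin 2) ℝ →ₐ[ℝ] K) := by
          refine MvPolynomial.algHom_ext fun i => ?_
          fin_cases i <;> simp [τ]
        exact DFunLike.congr_fun this G
      have := ih (τ G) (by rw [hτ, hshift G hG])
      rw [hτ] at this
      convert this using 4
      push_cast; ring
  -- View `F` as a polynomial in its first variable, with coefficients in `ℝ[u]`.
  let μ : MvPolynomial (Fin 1) ℝ →ₐ[ℝ] K := MvPolynomial.aeval ![u]
  have hμ : Function.Injective μ :=
    (algebraicIndependent_unique_type_iff (x := ![u])).2 (by simpa using hu)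
  have heval : ∀ v, MvPolynomial.aeval ![v, u] F =
      ((MvPolynomial.finSuccEquiv ℝ 1 F).map μ.toRingHom).eval v := by
    intro v
    have : (MvPolynomial.aeval ![v, u] : MvPolynomial (Fin 2) ℝ →ₐ[ℝ] K).toRingHom =
        ((Polynomial.evalRingHom v).comp (Polynomial.mapRingHom μ.toRingHom)).comp
          (MvPolynomial.finSuccEquiv ℝ 1).toRingEquiv.toRingHom := by
      refine MvPolynomial.ringHom_ext (fun r => ?_) fun i => ?_
      · simp [MvPolynomial.finSuccEquiv_apply]
      · refine Fin.cases ?_ (fun i => ?_) i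
        · simp [MvPolynomial.finSuccEquiv_X_zero]
        · simp [MvPolynomial.finSuccEquiv_X_succ, μ]
    exact DFunLike.congr_fun this F
  have hzero : (MvPolynomial.finSuccEquiv ℝ 1 F).map μ.toRingHom = 0 := by
    have : CharZero K := charZero_of_injective_algebraMap (algebraMap ℝ K).injective
    refine Polynomial.eq_zero_of_infinite_isRoot _ (Set.infinite_of_injective_forall_mem
      (f := fun k : ℕ => x + k * (algebraMap ℝ K c * u)) ?_ fun k => ?_)
    · intro k l hkl
      have hcu : algebraMap ℝ K c * u ≠ 0 := mul_ne_zero (by simpa using hc) hu0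
      exact_mod_cast mul_right_cancel₀ hcu (add_left_cancel hkl)
    · exact (heval _).symm.trans (key k F hF)
  have h0 := Polynomial.map_injective μ.toRingHom hμ (hzero.trans (Polynomial.map_zero _).symm)
  exact hF0 ((map_eq_zero_iff _ (MvPolynomial.finSuccEquiv ℝ 1).injective).1 h0)

/-- As the parametrization is proper, a generic point of the curve has one parameter. -/
theorem IsProper.eq_of_transcendental {X Y W : ℝ[X]} (h : IsProper X Y W) {E : Type*} [Field E]
    [Algebra ℝ E] {s s' : E} (hs : Transcendental ℝ s) (hs' : Transcendental ℝ s')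
    (hx : Polynomial.aeval s X / Polynomial.aeval s W =
      Polynomial.aeval s' X / Polynomial.aeval s' W)
    (hy : Polynomial.aeval s Y / Polynomial.aeval s W =
      Polynomial.aeval s' Y / Polynomial.aeval s' W) : s = s' := by
  have hle : ∀ {s : E}, Transcendental ℝ s → nonZeroDivisors ℝ[X] ≤
      (nonZeroDivisors E).comap (Polynomial.aeval s : ℝ[X] →ₐ[ℝ] E) := fun hs =>
    nonZeroDivisors_le_comap_nonZeroDivisors_of_injective _ (transcendental_iff_injective.1 hs)
  let ρ := RatFunc.liftAlgHom (Polynomial.aeval s) (hle hs)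
  let ρ' := RatFunc.liftAlgHom (Polynomial.aeval s') (hle hs')
  have hmem : ∀ z ∈ IntermediateField.adjoin ℝ
      ({algebraMap ℝ[X] (RatFunc ℝ) X / algebraMap ℝ[X] (RatFunc ℝ) W,
      algebraMap ℝ[X] (RatFunc ℝ) Y / algebraMap ℝ[X] (RatFunc ℝ) W} : Set (RatFunc ℝ)),
      ρ z = ρ' z := by
    intro z hz
    induction hz using IntermediateField.adjoin_induction with
    | mem z hz =>
      rcases hz with rfl | rfl
      · rw [RatFunc.liftAlgHom_apply_div, RatFunc.liftAlgHom_apply_div, hx]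
      · rw [RatFunc.liftAlgHom_apply_div, RatFunc.liftAlgHom_apply_div, hy]
    | algebraMap r => rw [AlgHom.commutes, AlgHom.commutes]
    | add z w _ _ hz hw => rw [map_add, map_add, hz, hw]
    | inv z _ hz => rw [map_inv₀, map_inv₀, hz]
    | mul z w _ _ hz hw => rw [map_mul, map_mul, hz, hw]
  have := hmem (algebraMap ℝ[X] _ Polynomial.X / algebraMap ℝ[X] _ 1)
    (by rw [show IntermediateField.adjoin ℝ _ = ⊤ from h]; trivial)
  rw [RatFunc.liftAlgHom_apply_div, RatFunc.liftAlgHom_apply_div] at this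
  simpa using this

end

noncomputable section

/-! ### The incidence relation between the offset and the auxiliary curve -/

/-- A vector of length `d` orthogonal to `(u, v)` is `d (v, -u) / β` with `β² = u² + v²`. -/
theorem exists_eq_smul_normal {E : Type*} [Field E] {u v e₁ e₂ δ : E} (hδ : δ ≠ 0)
    (huv : u ^ 2 + v ^ 2 ≠ 0) (h : u * e₁ + v * e₂ = 0) (he : e₁ ^ 2 + e₂ ^ 2 = δ ^ 2) :
    ∃ β, β ≠ 0 ∧ β ^ 2 = u ^ 2 + v ^ 2 ∧ e₁ = δ * (v / β) ∧ e₂ = -(δ * (u / β)) := by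
  -- The component along the normal `(v, -u)`.
  set l := (v * e₁ - u * e₂) / (u ^ 2 + v ^ 2) with hl
  have h1 : e₁ = l * v := by
    rw [hl]; field_simp; linear_combination u * h
  have h2 : e₂ = -(l * u) := by
    rw [hl]; field_simp; linear_combination v * h
  have hl2 : l ^ 2 * (u ^ 2 + v ^ 2) = δ ^ 2 := by
    rw [← he, h1, h2]; ring
  have hl0 : l ≠ 0 := by
    intro h0
    rw [h0] at hl2
    exact hδ (pow_eq_zero_iff two_ne_zero |>.1 (by rw [← hl2]; ring))
  refine ⟨δ / l, div_ne_zero hδ hl0, ?_, ?_, ?_⟩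
  · field_simp; exact hl2.symm
  · rw [h1]; field_simp
  · rw [h2]; field_simp

section Incidence

variable {E : Type*} [Field E] [Algebra ℝ E]

/-- Substitution of a point `(a, b)` for `(x, y)`. -/
def pointHom (a b : E) : MvPolynomial (Fin 2) ℝ →+* E :=
  (MvPolynomial.aeval ![a, b] : MvPolynomial (Fin 2) ℝ →ₐ[ℝ] E).toRingHom

theorem pointHom_apply (a b : E) (f : MvPolynomial (Fin 2) ℝ) :
    pointHom a b f = MvPolynomial.aeval ![a, b] f := rfl

@[simp]
theorem eval₂_pointHom_lift (a b s : E) (f : ℝ[X]) :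
    (lift f).eval₂ (pointHom a b) s = Polynomial.aeval s f := by
  have : (pointHom a b).comp MvPolynomial.C = algebraMap ℝ E := by
    ext r; simp [pointHom]
  rw [lift, Polynomial.eval₂_map, this, Polynomial.aeval_def]

@[simp]
theorem eval₂_pointHom_varx (a b s : E) : varx.eval₂ (pointHom a b) s = a := by
  simp [varx, pointHom]

@[simp]
theorem eval₂_pointHom_vary (a b s : E) : vary.eval₂ (pointHom a b) s = b := by
  simp [vary, pointHom]

theorem pointHom_algHom {F : Type*} [Field F] [Algebra ℝ F] (ρ : E →ₐ[ℝ] F) (a b : E) :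
    (ρ : E →+* F).comp (pointHom a b) = pointHom (ρ a) (ρ b) := by
  refine MvPolynomial.ringHom_ext (fun r => ?_) fun i => ?_
  · simp [pointHom]
  · fin_cases i <;> simp [pointHom]

variable (X Y W : ℝ[X]) [hM : Fact (Irreducible (auxPoly X Y W))] (d : ℝ)

theorem contP_ne_zero (hW : W ≠ 0) : contP X Y W ≠ 0 := by
  intro h
  have h1 := EuclideanDomain.gcd_eq_zero_iff.1 (EuclideanDomain.gcd_eq_zero_iff.1 h).1
  refine gcdUV_ne_zero X Y W (EuclideanDomain.gcd_eq_zero_iff.2 ⟨?_, ?_⟩)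
  · exact (mul_eq_zero.1 h1.1).resolve_right hW
  · exact (mul_eq_zero.1 h1.2).resolve_right hW

/-- Up to a factor `k` that vanishes only where `W` or both `Û` and `V̂` vanish, `P` is the equation
`Û (W x - X) + V̂ (W y - Y)` of the normal line. -/
theorem exists_lift_mul_polyP : ∃ k : ℝ[X], k ∣ hatU X Y W * W ∧ k ∣ hatV X Y W * W ∧
    lift k * polyP X Y W = lift (hatU X Y W) * (lift W * varx - lift X) +
      lift (hatV X Y W) * (lift W * vary - lift Y) := by
  have hg := gcdUV_ne_zero X Y W
  have hU := gcdUV_mul_hatU X Y W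
  have hV := gcdUV_mul_hatV X Y W
  obtain ⟨k, hk⟩ : gcdUV X Y W ∣ contP X Y W := by
    refine EuclideanDomain.dvd_gcd (EuclideanDomain.dvd_gcd ?_ ?_) ?_
    · exact Dvd.dvd.mul_right (EuclideanDomain.gcd_dvd_left _ _) _
    · exact Dvd.dvd.mul_right (EuclideanDomain.gcd_dvd_right _ _) _
    · exact dvd_add (Dvd.dvd.mul_right (EuclideanDomain.gcd_dvd_left _ _) _)
        (Dvd.dvd.mul_right (EuclideanDomain.gcd_dvd_right _ _) _)
  have h1 : contP X Y W ∣ polyU X W * W :=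
    (EuclideanDomain.gcd_dvd_left _ _).trans (EuclideanDomain.gcd_dvd_left _ _)
  have h2 : contP X Y W ∣ polyV Y W * W :=
    (EuclideanDomain.gcd_dvd_left _ _).trans (EuclideanDomain.gcd_dvd_right _ _)
  rw [hk, ← hU, mul_assoc, mul_dvd_mul_iff_left hg] at h1
  rw [hk, ← hV, mul_assoc, mul_dvd_mul_iff_left hg] at h2
  refine ⟨k, h1, h2, ?_⟩
  have hlg : lift (gcdUV X Y W) ≠ 0 :=
    (Polynomial.map_ne_zero_iff (MvPolynomial.C_injective _ _)).2 hg
  refine mul_left_cancel₀ hlg ?_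
  have := lift_contP_mul_polyP X Y W
  rw [hk, tildeP, ← hU, ← hV] at this
  simp only [lift, Polynomial.map_mul] at this ⊢
  linear_combination this

theorem eval₂_polyP_eq_zero_iff {a b s : E} (hW : Polynomial.aeval s W ≠ 0)
    (hH : Polynomial.aeval s (sumSq X Y W) ≠ 0) :
    (polyP X Y W).eval₂ (pointHom a b) s = 0 ↔
      Polynomial.aeval s (hatU X Y W) * (Polynomial.aeval s W * a - Polynomial.aeval s X) +
      Polynomial.aeval s (hatV X Y W) * (Polynomial.aeval s W * b - Polynomial.aeval s Y) = 0 := by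
  obtain ⟨k, hk1, hk2, hk⟩ := exists_lift_mul_polyP X Y W
  have hks : Polynomial.aeval s k ≠ 0 := by
    intro h0
    obtain ⟨u, hu⟩ := hk1
    obtain ⟨v, hv⟩ := hk2
    have hu := congrArg (Polynomial.aeval s) hu
    have hv := congrArg (Polynomial.aeval s) hv
    rw [map_mul, map_mul, h0, zero_mul] at hu hv
    apply hH
    rw [sumSq, map_add, map_pow, map_pow, (mul_eq_zero.1 hu).resolve_right hW,
      (mul_eq_zero.1 hv).resolve_right hW]
    ring
  have := congrArg (Polynomial.eval₂ (pointHom a b) s) hk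
  simp only [Polynomial.eval₂_mul, Polynomial.eval₂_add, Polynomial.eval₂_sub,
    eval₂_pointHom_lift, eval₂_pointHom_varx, eval₂_pointHom_vary] at this
  rw [← this, mul_eq_zero, or_iff_right hks]

omit hM in
theorem contQ_dvd : contQ X Y W d ∣ W ^ 2 :=
  (EuclideanDomain.gcd_dvd_left _ _).trans (EuclideanDomain.gcd_dvd_left _ _)

omit hM in
theorem aeval_contQ_ne_zero {s : E} (hW : Polynomial.aeval s W ≠ 0) :
    Polynomial.aeval s (contQ X Y W d) ≠ 0 := by
  intro h0
  obtain ⟨c, hc⟩ := contQ_dvd X Y W d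
  have := congrArg (Polynomial.aeval s) hc
  rw [map_mul, h0, zero_mul, map_pow] at this
  exact hW (pow_eq_zero_iff two_ne_zero |>.1 this)

omit hM in
theorem aeval_contQ_mul_eval₂_polyQ (a b s : E) :
    Polynomial.aeval s (contQ X Y W d) * (polyQ X Y W d).eval₂ (pointHom a b) s =
      (Polynomial.aeval s W * a - Polynomial.aeval s X) ^ 2 +
      (Polynomial.aeval s W * b - Polynomial.aeval s Y) ^ 2 -
      algebraMap ℝ E d ^ 2 * Polynomial.aeval s W ^ 2 := by
  have := congrArg (Polynomial.eval₂ (pointHom a b) s) (lift_contQ_mul_polyQ X Y W d)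
  rw [tildeQ] at this
  simpa only [Polynomial.eval₂_mul, Polynomial.eval₂_add, Polynomial.eval₂_sub,
    Polynomial.eval₂_pow, eval₂_pointHom_lift, eval₂_pointHom_varx, eval₂_pointHom_vary,
    map_mul, map_pow, Polynomial.aeval_C] using this

/-- Where `W` and `Û² + V̂²` do not vanish, the common zeros of `P` and `Q` are the points
`(x, y) = φ(t, α)` with `(t, α)` on the auxiliary curve. -/
theorem eval₂_polyP_polyQ_eq_zero_iff (hd : d ≠ 0) {a b s : E} (hW : Polynomial.aeval s W ≠ 0)
    (hH : Polynomial.aeval s (sumSq X Y W) ≠ 0) :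
    ((polyP X Y W).eval₂ (pointHom a b) s = 0 ∧ (polyQ X Y W d).eval₂ (pointHom a b) s = 0) ↔
      ∃ β, β ≠ 0 ∧ β ^ 2 = Polynomial.aeval s (sumSq X Y W) ∧
        a = Polynomial.aeval s X / Polynomial.aeval s W +
          algebraMap ℝ E d * (Polynomial.aeval s (hatV X Y W) / β) ∧
        b = Polynomial.aeval s Y / Polynomial.aeval s W -
          algebraMap ℝ E d * (Polynomial.aeval s (hatU X Y W) / β) := by
  have hd' : algebraMap ℝ E d ≠ 0 := by simpa using hd
  rw [eval₂_polyP_eq_zero_iff X Y W hW hH,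
    ← mul_eq_zero_iff_left (aeval_contQ_ne_zero X Y W d hW) (b := Polynomial.eval₂ _ _ _),
    aeval_contQ_mul_eval₂_polyQ]
  have hs : Polynomial.aeval s (sumSq X Y W) =
      Polynomial.aeval s (hatU X Y W) ^ 2 + Polynomial.aeval s (hatV X Y W) ^ 2 := by
    simp [sumSq]
  rw [hs] at hH ⊢
  generalize Polynomial.aeval s (hatU X Y W) = u at *
  generalize Polynomial.aeval s (hatV X Y W) = v at *
  generalize Polynomial.aeval s X = x at *
  generalize Polynomial.aeval s Y = y at *
  generalize Polynomial.aeval s W = w at *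
  constructor
  · rintro ⟨h1, h2⟩
    obtain ⟨β, hβ, hβ2, e1, e2⟩ := exists_eq_smul_normal (e₁ := a - x / w) (e₂ := b - y / w)
      hd' hH (by field_simp; linear_combination h1) (by field_simp; linear_combination h2)
    exact ⟨β, hβ, hβ2, by linear_combination e1, by linear_combination e2⟩
  · rintro ⟨β, hβ, hβ2, rfl, rfl⟩
    constructor
    · field_simp; ring
    · field_simp
      linear_combination (-algebraMap ℝ E d ^ 2 * w ^ 2) * hβ2

end Incidence

/-! ### The generic point of the offset -/

variable (X Y W : ℝ[X]) [hM : Fact (Irreducible (auxPoly X Y W))] (d : ℝ)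

/-- The first coordinate of the generic point of the offset. -/
def offX : AuxField X Y W :=
  Polynomial.aeval (auxT X Y W) X / Polynomial.aeval (auxT X Y W) W +
    algebraMap ℝ _ d * (Polynomial.aeval (auxT X Y W) (hatV X Y W) / auxA X Y W)

/-- The second coordinate of the generic point of the offset. -/
def offY : AuxField X Y W :=
  Polynomial.aeval (auxT X Y W) Y / Polynomial.aeval (auxT X Y W) W -
    algebraMap ℝ _ d * (Polynomial.aeval (auxT X Y W) (hatU X Y W) / auxA X Y W)

theorem aeval_auxT_ne_zero {f : ℝ[X]} (hf : f ≠ 0) : Polynomial.aeval (auxT X Y W) f ≠ 0 :=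
  (aeval_auxT_eq_zero_iff X Y W).not.2 hf

/-- At the generic point of the offset, its generator `t` is a common root of `P` and `Q`. -/
theorem generic_mem_polyP_polyQ (hd : d ≠ 0) (hW : W ≠ 0) :
    (polyP X Y W).eval₂ (pointHom (offX X Y W d) (offY X Y W d)) (auxT X Y W) = 0 ∧
      (polyQ X Y W d).eval₂ (pointHom (offX X Y W d) (offY X Y W d)) (auxT X Y W) = 0 :=
  (eval₂_polyP_polyQ_eq_zero_iff X Y W d hd (aeval_auxT_ne_zero X Y W hW)
    (aeval_auxT_ne_zero X Y W (sumSq_ne_zero X Y W))).2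
    ⟨auxA X Y W, auxA_ne_zero X Y W, auxA_sq X Y W, rfl, rfl⟩

/-- The offset is not contained in a line. -/
theorem offset_linearIndependent (hd : d ≠ 0) (hW : W ≠ 0) {c₁ c₂ c₃ : ℝ}
    (h : algebraMap ℝ _ c₁ * offX X Y W d + algebraMap ℝ _ c₂ * offY X Y W d +
      algebraMap ℝ _ c₃ = 0) : c₁ = 0 ∧ c₂ = 0 ∧ c₃ = 0 := by
  have hw := aeval_auxT_ne_zero X Y W hW
  have hα := auxA_ne_zero X Y W
  have hα2 := auxA_sq X Y W
  have key := aeval_add_mul_auxA_eq_zero X Y W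
    (p := sumSq X Y W * (Polynomial.C c₁ * X + Polynomial.C c₂ * Y + Polynomial.C c₃ * W))
    (q := Polynomial.C d * W * (Polynomial.C c₁ * hatV X Y W - Polynomial.C c₂ * hatU X Y W)) (by
      simp only [map_mul, map_add, map_sub, Polynomial.aeval_C]
      rw [← hα2]
      rw [offX, offY] at h
      field_simp at h
      linear_combination auxA X Y W * h)
  have h1 := (mul_eq_zero.1 key.2).resolve_left
    (mul_ne_zero (by simpa using hd) hW)
  have h2 := hat_linearIndependent X Y W (c₁ := -c₂) (c₂ := c₁) (by
    rw [Polynomial.C_neg]; linear_combination h1)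
  have hc₁ := h2.2
  have hc₂ := neg_eq_zero.1 h2.1
  subst hc₁ hc₂
  refine ⟨rfl, rfl, ?_⟩
  have h3 := (mul_eq_zero.1 key.1).resolve_left (sumSq_ne_zero X Y W)
  simpa [hW] using h3

/-- The tangent direction of the offset at its generic point is that of the curve. -/
theorem exists_derivation_offset (hW : W ≠ 0) :
    ∃ (D : Derivation ℝ (AuxField X Y W) (AuxField X Y W)) (μ : AuxField X Y W), μ ≠ 0 ∧
      D (offX X Y W d) = μ * Polynomial.aeval (auxT X Y W) (hatU X Y W) ∧
      D (offY X Y W d) = μ * Polynomial.aeval (auxT X Y W) (hatV X Y W) := by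
  obtain ⟨D, hD⟩ := exists_derivation X Y W
  have hw := aeval_auxT_ne_zero X Y W hW
  have hα := auxA_ne_zero X Y W
  have hα2 := auxA_sq X Y W
  have hDα : auxA X Y W * D (auxA X Y W) =
      Polynomial.aeval (auxT X Y W) (hatU X Y W) *
        Polynomial.aeval (auxT X Y W) (Polynomial.derivative (hatU X Y W)) +
      Polynomial.aeval (auxT X Y W) (hatV X Y W) *
        Polynomial.aeval (auxT X Y W) (Polynomial.derivative (hatV X Y W)) := by
    have := congrArg D hα2
    rw [Derivation.map_aeval, hD, sumSq] at this
    simp only [sq, Derivation.leibniz, Polynomial.derivative_mul, map_add, map_mul, smul_eq_mul,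
      mul_one] at this
    apply mul_left_cancel₀ (two_ne_zero (α := AuxField X Y W))
    linear_combination this
  have hUg := congrArg (Polynomial.aeval (auxT X Y W)) (gcdUV_mul_hatU X Y W)
  have hVg := congrArg (Polynomial.aeval (auxT X Y W)) (gcdUV_mul_hatV X Y W)
  rw [polyU] at hUg
  rw [polyV] at hVg
  simp only [map_mul, map_sub] at hUg hVg
  rw [sumSq, map_add, map_pow, map_pow] at hα2
  refine ⟨D, Polynomial.aeval (auxT X Y W) (gcdUV X Y W) / Polynomial.aeval (auxT X Y W) W ^ 2 +
    algebraMap ℝ _ d * (Polynomial.aeval (auxT X Y W) (hatU X Y W) *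
      Polynomial.aeval (auxT X Y W) (Polynomial.derivative (hatV X Y W)) -
      Polynomial.aeval (auxT X Y W) (hatV X Y W) *
      Polynomial.aeval (auxT X Y W) (Polynomial.derivative (hatU X Y W))) / auxA X Y W ^ 3,
    ?_, ?_, ?_⟩
  · intro h
    have key := aeval_add_mul_auxA_eq_zero X Y W
      (p := gcdUV X Y W * sumSq X Y W ^ 2)
      (q := Polynomial.C d * W ^ 2 * (hatU X Y W * Polynomial.derivative (hatV X Y W) -
        hatV X Y W * Polynomial.derivative (hatU X Y W))) (by
        simp only [map_mul, map_sub, map_pow, Polynomial.aeval_C]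
        rw [← auxA_sq]
        field_simp at h
        linear_combination auxA X Y W * h)
    exact mul_ne_zero (gcdUV_ne_zero X Y W) (pow_ne_zero 2 (sumSq_ne_zero X Y W)) key.1
  · rw [offX]
    simp only [map_add, Derivation.leibniz, Derivation.leibniz_div, Derivation.map_aeval, hD,
      Derivation.map_algebraMap, smul_eq_mul, mul_one, mul_zero, add_zero]
    generalize D (auxA X Y W) = z at *
    field_simp
    linear_combination (-auxA X Y W ^ 3) * hUg + Polynomial.aeval (auxT X Y W) W ^ 2 *
      algebraMap ℝ (AuxField X Y W) d *
        (Polynomial.aeval (auxT X Y W) (Polynomial.derivative (hatV X Y W)) * hα2 -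
          Polynomial.aeval (auxT X Y W) (hatV X Y W) * hDα)
  · rw [offY]
    simp only [map_sub, Derivation.leibniz, Derivation.leibniz_div, Derivation.map_aeval, hD,
      Derivation.map_algebraMap, smul_eq_mul, mul_one, mul_zero, add_zero]
    generalize D (auxA X Y W) = z at *
    field_simp
    linear_combination (-auxA X Y W ^ 3) * hVg - Polynomial.aeval (auxT X Y W) W ^ 2 *
      algebraMap ℝ (AuxField X Y W) d *
        (Polynomial.aeval (auxT X Y W) (Polynomial.derivative (hatU X Y W)) * hα2 -
          Polynomial.aeval (auxT X Y W) (hatU X Y W) * hDα)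

end

noncomputable section

/-! ### Uniqueness of the generator of a generic point of the offset -/

variable (X Y W : ℝ[X]) [hM : Fact (Irreducible (auxPoly X Y W))] (d : ℝ)

/-- The three coefficients of `P`, as a linear polynomial in `x`, `y`, are coprime. -/
theorem exists_coeff_polyP_combination (hW : W ≠ 0) : ∃ e f g : ℝ[X],
    e * (polyU X W * W / contP X Y W) + f * (polyV Y W * W / contP X Y W) +
      g * ((polyU X W * X + polyV Y W * Y) / contP X Y W) = 1 := by
  have hc := contP_ne_zero X Y W hW
  have h1 : contP X Y W ∣ polyU X W * W :=
    (EuclideanDomain.gcd_dvd_left _ _).trans (EuclideanDomain.gcd_dvd_left _ _)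
  have h2 : contP X Y W ∣ polyV Y W * W :=
    (EuclideanDomain.gcd_dvd_left _ _).trans (EuclideanDomain.gcd_dvd_right _ _)
  have h3 : contP X Y W ∣ polyU X W * X + polyV Y W * Y := EuclideanDomain.gcd_dvd_right _ _
  have e1 := EuclideanDomain.mul_div_cancel' hc h1
  have e2 := EuclideanDomain.mul_div_cancel' hc h2
  have e3 := EuclideanDomain.mul_div_cancel' hc h3
  have b1 := EuclideanDomain.gcd_eq_gcd_ab
    (EuclideanDomain.gcd (polyU X W * W) (polyV Y W * W)) (polyU X W * X + polyV Y W * Y)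
  have b2 := EuclideanDomain.gcd_eq_gcd_ab (polyU X W * W) (polyV Y W * W)
  rw [b2] at b1
  rw [← b2, ← contP] at b1
  generalize EuclideanDomain.gcdA (EuclideanDomain.gcd (polyU X W * W) (polyV Y W * W))
    (polyU X W * X + polyV Y W * Y) = r at b1
  generalize EuclideanDomain.gcdB (EuclideanDomain.gcd (polyU X W * W) (polyV Y W * W))
    (polyU X W * X + polyV Y W * Y) = s at b1
  refine ⟨EuclideanDomain.gcdA (polyU X W * W) (polyV Y W * W) * r,
    EuclideanDomain.gcdB (polyU X W * W) (polyV Y W * W) * r, s, mul_left_cancel₀ hc ?_⟩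
  rw [b2] at b1
  linear_combination EuclideanDomain.gcdA (polyU X W * W) (polyV Y W * W) * r * e1 +
    EuclideanDomain.gcdB (polyU X W * W) (polyV Y W * W) * r * e2 + s * e3 - b1

omit hM in
theorem eval₂_polyP {E : Type*} [Field E] [Algebra ℝ E] (a b s : E) :
    (polyP X Y W).eval₂ (pointHom a b) s =
      Polynomial.aeval s (polyU X W * W / contP X Y W) * a +
      Polynomial.aeval s (polyV Y W * W / contP X Y W) * b -
      Polynomial.aeval s ((polyU X W * X + polyV Y W * Y) / contP X Y W) := by
  simp only [polyP, Polynomial.eval₂_mul, Polynomial.eval₂_add, Polynomial.eval₂_sub,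
    eval₂_pointHom_lift, eval₂_pointHom_varx, eval₂_pointHom_vary]

/-- Two unit vectors `(v / α, -u / α)` and `(v' / β, -u' / β)` with parallel `(u, v)` and
`(u', v')` agree up to sign. -/
theorem normal_eq_or_eq_neg {E : Type*} [Field E] {u v α u' v' β : E} (hα : α ≠ 0) (hβ : β ≠ 0)
    (h : α ^ 2 = u ^ 2 + v ^ 2) (h' : β ^ 2 = u' ^ 2 + v' ^ 2) (huv : u * v' = u' * v) :
    (u' / β = u / α ∧ v' / β = v / α) ∨ (u' / β = -(u / α) ∧ v' / β = -(v / α)) := by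
  -- The cosine of the angle between the vectors.
  set δ := (u * u' + v * v') / (α * β) with hδ
  have h1 : δ ^ 2 = 1 := by
    rw [hδ, div_pow, div_eq_one_iff_eq (pow_ne_zero 2 (mul_ne_zero hα hβ)), mul_pow, h, h']
    linear_combination (-(u * v') + u' * v) * huv
  have h2 : u' / β = δ * (u / α) := by
    rw [hδ]; field_simp
    linear_combination u' * h - v * huv
  have h3 : v' / β = δ * (v / α) := by
    rw [hδ]; field_simp
    linear_combination v' * h + u * huv
  rcases sq_eq_sq_iff_eq_or_eq_neg.1 (h1.trans (one_pow 2).symm) with e | e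
  · exact Or.inl ⟨by rw [h2, e, one_mul], by rw [h3, e, one_mul]⟩
  · exact Or.inr ⟨by rw [h2, e]; ring, by rw [h3, e]; ring⟩

section Closure

variable {L : Type} [Field L] [Algebra ℝ L] [Algebra (AuxField X Y W) L]
  [IsScalarTower ℝ (AuxField X Y W) L] [IsAlgClosed L]

/-- A root of `P` at the generic point of the offset is not a constant, because the offset is not
contained in a line. -/
theorem transcendental_of_eval₂_polyP_eq_zero (hd : d ≠ 0) (hW : W ≠ 0) {s : L}
    (hP : (polyP X Y W).eval₂ (pointHom (algebraMap _ L (offX X Y W d))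
      (algebraMap _ L (offY X Y W d))) s = 0) : Transcendental ℝ s := by
  intro hs
  let j : ℂ →ₐ[ℝ] L := IsAlgClosed.lift
  obtain ⟨z, rfl⟩ := exists_complex_of_isAlgebraic j hs
  rw [eval₂_polyP] at hP
  simp only [Polynomial.aeval_algHom_apply] at hP
  obtain ⟨e, f, g, hefg⟩ := exists_coeff_polyP_combination X Y W hW
  have hefg := congrArg (Polynomial.aeval z) hefg
  simp only [map_add, map_mul, map_one] at hefg
  generalize Polynomial.aeval z (polyU X W * W / contP X Y W) = p at *
  generalize Polynomial.aeval z (polyV Y W * W / contP X Y W) = q at *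
  generalize Polynomial.aeval z ((polyU X W * X + polyV Y W * Y) / contP X Y W) = r at *
  have hj : ∀ w : ℂ, j w = algebraMap (AuxField X Y W) L (algebraMap ℝ _ w.re) +
      j Complex.I * algebraMap (AuxField X Y W) L (algebraMap ℝ _ w.im) := by
    intro w
    conv_lhs => rw [← Complex.re_add_im w]
    rw [map_add, map_mul, ← IsScalarTower.algebraMap_apply, ← IsScalarTower.algebraMap_apply,
      mul_comm]
    congr 1
    · exact j.commutes _
    · congr 1; exact j.commutes _
  rw [hj p, hj q, hj r] at hP
  obtain ⟨h1, h2⟩ := add_I_mul_eq_zero (sq_ne_neg_one X Y W) j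
    (u := algebraMap ℝ _ p.re * offX X Y W d + algebraMap ℝ _ q.re * offY X Y W d +
      algebraMap ℝ _ (-r.re))
    (v := algebraMap ℝ _ p.im * offX X Y W d + algebraMap ℝ _ q.im * offY X Y W d +
      algebraMap ℝ _ (-r.im)) (by
      simp only [map_add, map_mul, map_neg]
      linear_combination hP)
  obtain ⟨p1, q1, r1⟩ := offset_linearIndependent X Y W d hd hW h1
  obtain ⟨p2, q2, r2⟩ := offset_linearIndependent X Y W d hd hW h2
  have hp : p = 0 := Complex.ext p1 p2
  have hq : q = 0 := Complex.ext q1 q2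
  have hr : r = 0 := Complex.ext (neg_eq_zero.1 r1) (neg_eq_zero.1 r2)
  rw [hp, hq, hr] at hefg
  simp at hefg

/-- A coordinate of the unit normal vector is not constant. -/
theorem transcendental_hatV_div :
    Transcendental ℝ (Polynomial.aeval (auxT X Y W) (hatV X Y W) / auxA X Y W) := by
  intro h
  obtain ⟨c, hc⟩ := exists_eq_algebraMap_of_isAlgebraic (sq_ne_neg_one X Y W) h
  rw [div_eq_iff (auxA_ne_zero X Y W)] at hc
  refine hatV_ne_zero X Y W (aeval_add_mul_auxA_eq_zero X Y W (q := -Polynomial.C c) ?_).1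
  rw [map_neg, Polynomial.aeval_C, hc]
  ring

omit [IsAlgClosed L] in
/-- The curve is not its own offset at distance `2 d`, traced along the normals: no homomorphism
moves `(X / W, Y / W)` by `2 d` times the unit normal vector and preserves that vector. -/
theorem algHom_ne_normal_translation (hd : d ≠ 0)
    (θ : AuxField X Y W →ₐ[ℝ] L)
    (hN : θ (Polynomial.aeval (auxT X Y W) (hatV X Y W) / auxA X Y W) =
      algebraMap _ L (Polynomial.aeval (auxT X Y W) (hatV X Y W) / auxA X Y W)) :
    θ (Polynomial.aeval (auxT X Y W) X / Polynomial.aeval (auxT X Y W) W) ≠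
      algebraMap _ L (Polynomial.aeval (auxT X Y W) X / Polynomial.aeval (auxT X Y W) W +
        algebraMap ℝ _ (2 * d) * (Polynomial.aeval (auxT X Y W) (hatV X Y W) / auxA X Y W)) :=
  algHom_ne_translation (IsScalarTower.toAlgHom ℝ (AuxField X Y W) L) θ
    (transcendental_hatV_div X Y W) (not_algebraicIndependent X Y W _ _) hN
    (mul_ne_zero two_ne_zero hd)

/-- The generic point of the offset is generated by one point of the curve only. Another generator
would have the same normal line, as the direction of the normal is determined by the tangent of the
offset; so it would be the point at distance `2 d` on the normal. -/
theorem eq_auxT_of_common_root (hproper : IsProper X Y W) (hd : d ≠ 0) (hW : W ≠ 0) {s : L}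
    (hP : (polyP X Y W).eval₂ (pointHom (algebraMap _ L (offX X Y W d))
      (algebraMap _ L (offY X Y W d))) s = 0)
    (hQ : (polyQ X Y W d).eval₂ (pointHom (algebraMap _ L (offX X Y W d))
      (algebraMap _ L (offY X Y W d))) s = 0) : s = algebraMap _ L (auxT X Y W) := by
  have hs := transcendental_of_eval₂_polyP_eq_zero X Y W d hd hW hP
  have hne : ∀ {f : ℝ[X]}, f ≠ 0 → Polynomial.aeval s f ≠ 0 := fun hf h =>
    hf ((transcendental_iff.1 hs) _ h)
  obtain ⟨β, hβ, hβ2, ha, hb⟩ := (eval₂_polyP_polyQ_eq_zero_iff X Y W d hd (hne hW)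
    (hne (sumSq_ne_zero X Y W))).1 ⟨hP, hQ⟩
  set ι := IsScalarTower.toAlgHom ℝ (AuxField X Y W) L with hι
  have hιa : ∀ z, algebraMap (AuxField X Y W) L z = ι z := fun _ => rfl
  have hιp : ∀ f : ℝ[X], ι (Polynomial.aeval (auxT X Y W) f) =
    Polynomial.aeval (ι (auxT X Y W)) f := fun f => (Polynomial.aeval_algHom_apply ι _ f).symm
  obtain ⟨ρ, hρt, hρα⟩ := exists_algHom_of_transcendental X Y W hs hβ2
  have hρp : ∀ f : ℝ[X], ρ (Polynomial.aeval (auxT X Y W) f) = Polynomial.aeval s f := fun f => by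
    rw [← Polynomial.aeval_algHom_apply, hρt]
  have hρa : ρ (offX X Y W d) = ι (offX X Y W d) := by
    rw [← hιa, ha, offX]
    simp only [map_add, map_mul, map_div₀, hρp, hρα, AlgHom.commutes]
  have hρb : ρ (offY X Y W d) = ι (offY X Y W d) := by
    rw [← hιa, hb, offY]
    simp only [map_sub, map_mul, map_div₀, hρp, hρα, AlgHom.commutes]
  -- The directions of the normals at both generators agree with the normal of the offset.
  have hcross : ι (Polynomial.aeval (auxT X Y W) (hatU X Y W)) * Polynomial.aeval s (hatV X Y W) =
      Polynomial.aeval s (hatU X Y W) * ι (Polynomial.aeval (auxT X Y W) (hatV X Y W)) := by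
    obtain ⟨D, μ, hμ, hDa, hDb⟩ := exists_derivation_offset X Y W d hW
    obtain ⟨F₁, F₂, hF, hF0⟩ := exists_linear_relation D
      (not_algebraicIndependent X Y W (offX X Y W d) (offY X Y W d))
    rw [hDa, hDb] at hF
    have hF' : MvPolynomial.aeval ![offX X Y W d, offY X Y W d] F₁ *
        Polynomial.aeval (auxT X Y W) (hatU X Y W) +
        MvPolynomial.aeval ![offX X Y W d, offY X Y W d] F₂ *
        Polynomial.aeval (auxT X Y W) (hatV X Y W) = 0 :=
      mul_left_cancel₀ hμ (by linear_combination hF)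
    have hF2 : ∀ F : MvPolynomial (Fin 2) ℝ,
        ρ (MvPolynomial.aeval ![offX X Y W d, offY X Y W d] F) =
          ι (MvPolynomial.aeval ![offX X Y W d, offY X Y W d] F) := by
      intro F
      have : ρ.comp (MvPolynomial.aeval ![offX X Y W d, offY X Y W d]) =
          ι.comp (MvPolynomial.aeval ![offX X Y W d, offY X Y W d]) := by
        refine MvPolynomial.algHom_ext fun i => ?_
        fin_cases i <;> simp [hρa, hρb]
      exact DFunLike.congr_fun this F
    have e1 := congrArg ι hF'
    have e2 := congrArg ρ hF'
    simp only [map_add, map_mul, map_zero, hF2, hρp] at e1 e2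
    rcases hF0 with h | h
    · refine mul_left_cancel₀ ((map_ne_zero ι).2 h) ?_
      linear_combination Polynomial.aeval s (hatV X Y W) * e1 -
        ι (Polynomial.aeval (auxT X Y W) (hatV X Y W)) * e2
    · refine mul_left_cancel₀ ((map_ne_zero ι).2 h) ?_
      linear_combination ι (Polynomial.aeval (auxT X Y W) (hatU X Y W)) * e2 -
        Polynomial.aeval s (hatU X Y W) * e1
  have hα : ι (auxA X Y W) ≠ 0 := (map_ne_zero ι).2 (auxA_ne_zero X Y W)
  have hα2 : ι (auxA X Y W) ^ 2 = ι (Polynomial.aeval (auxT X Y W) (hatU X Y W)) ^ 2 +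
      ι (Polynomial.aeval (auxT X Y W) (hatV X Y W)) ^ 2 := by
    rw [← map_pow, auxA_sq, sumSq]; simp only [map_add, map_pow]
  have hβ2' : β ^ 2 = Polynomial.aeval s (hatU X Y W) ^ 2 +
      Polynomial.aeval s (hatV X Y W) ^ 2 := by
    rw [hβ2, sumSq]; simp only [map_add, map_pow]
  rw [hιa, offX] at ha
  rw [hιa, offY] at hb
  simp only [map_add, map_sub, map_mul, map_div₀, AlgHom.commutes] at ha hb
  rcases normal_eq_or_eq_neg hα hβ hα2 hβ2' hcross with ⟨e1, e2⟩ | ⟨e1, e2⟩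
  · refine hproper.eq_of_transcendental hs ?_ ?_ ?_
    · exact (transcendental_algebraMap_iff (FaithfulSMul.algebraMap_injective
        (AuxField X Y W) L)).2 (transcendental_auxT X Y W)
    · rw [hιa, ← hιp, ← hιp]
      linear_combination -ha - algebraMap ℝ L d * e2
    · rw [hιa, ← hιp, ← hιp]
      linear_combination -hb + algebraMap ℝ L d * e1
  · exfalso
    obtain ⟨θ, hθt, hθα⟩ := exists_algHom_of_transcendental X Y W hs
      (β := -β) (by rw [neg_sq, hβ2])
    have hθp : ∀ f : ℝ[X], θ (Polynomial.aeval (auxT X Y W) f) = Polynomial.aeval s f := fun f => by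
      rw [← Polynomial.aeval_algHom_apply, hθt]
    refine algHom_ne_normal_translation X Y W d hd θ ?_ ?_
    · rw [hιa, map_div₀, map_div₀, hθp, hθα, div_neg, e2, neg_neg]
    · rw [hιa]
      simp only [map_add, map_mul, map_div₀, AlgHom.commutes, hθp, map_ofNat]
      linear_combination -ha - algebraMap ℝ L d * e2

end Closure

end

noncomputable section

/-! ### The first subresultant at the generic point -/

variable (X Y W : ℝ[X]) [hM : Fact (Irreducible (auxPoly X Y W))] (d : ℝ)

/-- Substitution of the generic point of the offset for `(x, y)`. -/
def genericHom : MvPolynomial (Fin 2) ℝ →+* AuxField X Y W :=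
  pointHom (offX X Y W d) (offY X Y W d)

omit hM in
theorem coeff_polyP (j : ℕ) : (polyP X Y W).coeff j =
    MvPolynomial.C ((polyU X W * W / contP X Y W).coeff j) * MvPolynomial.X 0 +
    MvPolynomial.C ((polyV Y W * W / contP X Y W).coeff j) * MvPolynomial.X 1 -
    MvPolynomial.C (((polyU X W * X + polyV Y W * Y) / contP X Y W).coeff j) := by
  simp [polyP, lift, varx, vary]

/-- No coefficient of `P` becomes zero at the generic point, since the coefficients are linear in
`x`, `y`. In particular the degree of `P` is preserved. -/
theorem coeff_polyP_eq_zero (hd : d ≠ 0) (hW : W ≠ 0) {j : ℕ}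
    (h : genericHom X Y W d ((polyP X Y W).coeff j) = 0) : (polyP X Y W).coeff j = 0 := by
  rw [coeff_polyP] at h ⊢
  obtain ⟨h1, h2, h3⟩ := offset_linearIndependent X Y W d hd hW
    (c₁ := (polyU X W * W / contP X Y W).coeff j) (c₂ := (polyV Y W * W / contP X Y W).coeff j)
    (c₃ := -((polyU X W * X + polyV Y W * Y) / contP X Y W).coeff j)
    (by rw [← h]; simp [genericHom, pointHom, sub_eq_add_neg])
  rw [h1, h2, neg_eq_zero.1 h3]
  simp

theorem polyP_ne_zero (hW : W ≠ 0) : polyP X Y W ≠ 0 := by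
  intro h
  -- The statement does not involve the distance; it is proved with the offset at distance `1`.
  have hc : ∀ j, (polyU X W * W / contP X Y W).coeff j = 0 ∧
      (polyV Y W * W / contP X Y W).coeff j = 0 ∧
      ((polyU X W * X + polyV Y W * Y) / contP X Y W).coeff j = 0 := by
    intro j
    obtain ⟨h1, h2, h3⟩ := offset_linearIndependent X Y W 1 one_ne_zero hW
      (c₁ := (polyU X W * W / contP X Y W).coeff j) (c₂ := (polyV Y W * W / contP X Y W).coeff j)
      (c₃ := -((polyU X W * X + polyV Y W * Y) / contP X Y W).coeff j) (by
        have := congrArg (genericHom X Y W 1) (coeff_polyP X Y W j)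
        rw [h] at this
        simpa [genericHom, pointHom, sub_eq_add_neg] using this.symm)
    exact ⟨h1, h2, neg_eq_zero.1 h3⟩
  obtain ⟨e, f, g, hefg⟩ := exists_coeff_polyP_combination X Y W hW
  rw [Polynomial.ext fun j => (hc j).1.trans (Polynomial.coeff_zero j).symm,
    Polynomial.ext fun j => (hc j).2.1.trans (Polynomial.coeff_zero j).symm,
    Polynomial.ext fun j => (hc j).2.2.trans (Polynomial.coeff_zero j).symm] at hefg
  simp at hefg

theorem natDegree_map_polyP (hd : d ≠ 0) (hW : W ≠ 0) :
    ((polyP X Y W).map (genericHom X Y W d)).natDegree = (polyP X Y W).natDegree :=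
  Polynomial.natDegree_map_of_leadingCoeff_ne_zero _ fun h =>
    polyP_ne_zero X Y W hW (Polynomial.leadingCoeff_eq_zero.1 (coeff_polyP_eq_zero X Y W d hd hW h))

theorem map_polyP_ne_zero (hd : d ≠ 0) (hW : W ≠ 0) :
    (polyP X Y W).map (genericHom X Y W d) ≠ 0 := fun h =>
  polyP_ne_zero X Y W hW (Polynomial.ext fun j => by
    rw [Polynomial.coeff_zero]
    refine coeff_polyP_eq_zero X Y W d hd hW ?_
    rw [← Polynomial.coeff_map, h, Polynomial.coeff_zero])

theorem eval_map_polyP (hd : d ≠ 0) (hW : W ≠ 0) :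
    ((polyP X Y W).map (genericHom X Y W d)).eval (auxT X Y W) = 0 := by
  rw [Polynomial.eval_map]; exact (generic_mem_polyP_polyQ X Y W d hd hW).1

theorem eval_map_polyQ (hd : d ≠ 0) (hW : W ≠ 0) :
    ((polyQ X Y W d).map (genericHom X Y W d)).eval (auxT X Y W) = 0 := by
  rw [Polynomial.eval_map]; exact (generic_mem_polyP_polyQ X Y W d hd hW).2

theorem map_genericHom_lift (f : ℝ[X]) :
    (lift f).map (genericHom X Y W d) = f.map (algebraMap ℝ (AuxField X Y W)) := by
  rw [lift, Polynomial.map_map]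
  congr 1
  ext r
  simp [genericHom, pointHom]

theorem map_genericHom_varx :
    varx.map (genericHom X Y W d) = Polynomial.C (offX X Y W d) := by
  simp [varx, genericHom, pointHom]

theorem map_genericHom_vary :
    vary.map (genericHom X Y W d) = Polynomial.C (offY X Y W d) := by
  simp [vary, genericHom, pointHom]

/-- The generator of the generic point is a simple root of `P`. -/
theorem eval_derivative_map_polyP_ne_zero (hd : d ≠ 0) (hW : W ≠ 0) :
    ((polyP X Y W).map (genericHom X Y W d)).derivative.eval (auxT X Y W) ≠ 0 := by
  intro h0
  obtain ⟨k, -, -, hk⟩ := exists_lift_mul_polyP X Y W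
  have h := congrArg (fun p => (p.map (genericHom X Y W d)).derivative.eval (auxT X Y W)) hk
  simp only [Polynomial.map_mul, Polynomial.map_add, Polynomial.map_sub, map_genericHom_lift,
    map_genericHom_varx, map_genericHom_vary, Polynomial.derivative_mul, Polynomial.derivative_add,
    Polynomial.derivative_sub, Polynomial.derivative_map, Polynomial.derivative_C,
    Polynomial.eval_add, Polynomial.eval_sub, Polynomial.eval_mul, Polynomial.eval_C,
    Polynomial.eval_map_algebraMap, mul_zero, add_zero] at h
  rw [← Polynomial.derivative_map, h0, eval_map_polyP X Y W d hd hW] at h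
  have hw := aeval_auxT_ne_zero X Y W hW
  have hα := auxA_ne_zero X Y W
  have hα2 := auxA_sq X Y W
  have hUg := congrArg (Polynomial.aeval (auxT X Y W)) (gcdUV_mul_hatU X Y W)
  have hVg := congrArg (Polynomial.aeval (auxT X Y W)) (gcdUV_mul_hatV X Y W)
  rw [polyU] at hUg
  rw [polyV] at hVg
  simp only [map_mul, map_sub] at hUg hVg
  have key := aeval_add_mul_auxA_eq_zero X Y W
    (p := -(gcdUV X Y W * sumSq X Y W ^ 2))
    (q := Polynomial.C d * W ^ 2 * (Polynomial.derivative (hatU X Y W) * hatV X Y W -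
      hatU X Y W * Polynomial.derivative (hatV X Y W))) (by
      simp only [map_neg, map_mul, map_sub, map_pow, Polynomial.aeval_C]
      rw [offX, offY] at h
      field_simp at h
      rw [sumSq] at hα2 ⊢
      simp only [map_add, map_pow] at hα2 ⊢
      linear_combination (-auxA X Y W) * h -
        auxA X Y W ^ 2 * Polynomial.aeval (auxT X Y W) (hatU X Y W) * hUg -
        auxA X Y W ^ 2 * Polynomial.aeval (auxT X Y W) (hatV X Y W) * hVg +
        Polynomial.aeval (auxT X Y W) (gcdUV X Y W) *
          (Polynomial.aeval (auxT X Y W) (hatU X Y W) ^ 2 +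
            Polynomial.aeval (auxT X Y W) (hatV X Y W) ^ 2) * hα2)
  exact mul_ne_zero (gcdUV_ne_zero X Y W) (pow_ne_zero 2 (sumSq_ne_zero X Y W))
    (neg_eq_zero.1 key.1)

theorem map_contQ_mul_map_polyQ :
    (contQ X Y W d).map (algebraMap ℝ (AuxField X Y W)) *
      (polyQ X Y W d).map (genericHom X Y W d) =
      (W.map (algebraMap ℝ _) * Polynomial.C (offX X Y W d) - X.map (algebraMap ℝ _)) ^ 2 +
      (W.map (algebraMap ℝ _) * Polynomial.C (offY X Y W d) - Y.map (algebraMap ℝ _)) ^ 2 -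
      Polynomial.C (algebraMap ℝ _ d) ^ 2 * W.map (algebraMap ℝ _) ^ 2 := by
  have h := congrArg (Polynomial.map (genericHom X Y W d)) (lift_contQ_mul_polyQ X Y W d)
  rw [tildeQ] at h
  simpa only [Polynomial.map_mul, Polynomial.map_add, Polynomial.map_sub, Polynomial.map_pow,
    map_genericHom_lift, map_genericHom_varx, map_genericHom_vary, Polynomial.map_C, map_pow]
    using h

/-- The generator of the generic point is a multiple root of `Q`, because the circle around the
generic point is tangent to the curve. -/
theorem eval_derivative_map_polyQ (hd : d ≠ 0) (hW : W ≠ 0) :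
    ((polyQ X Y W d).map (genericHom X Y W d)).derivative.eval (auxT X Y W) = 0 := by
  have h := congrArg (fun p => p.derivative.eval (auxT X Y W)) (map_contQ_mul_map_polyQ X Y W d)
  have hw := aeval_auxT_ne_zero X Y W hW
  have hα := auxA_ne_zero X Y W
  have hα2 := auxA_sq X Y W
  have hUg := congrArg (Polynomial.aeval (auxT X Y W)) (gcdUV_mul_hatU X Y W)
  have hVg := congrArg (Polynomial.aeval (auxT X Y W)) (gcdUV_mul_hatV X Y W)
  rw [polyU] at hUg
  rw [polyV] at hVg
  simp only [map_mul, map_sub] at hUg hVg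
  rw [sumSq] at hα2
  simp only [map_add, map_pow] at hα2
  refine (mul_eq_zero.1 ?_).resolve_left (aeval_contQ_ne_zero X Y W d hw)
  simp only [sq, Polynomial.derivative_mul, Polynomial.derivative_add,
    Polynomial.derivative_sub, Polynomial.derivative_C,
    Polynomial.eval_add, Polynomial.eval_sub, Polynomial.eval_mul, Polynomial.eval_C,
    mul_zero, zero_mul, add_zero, zero_add, eval_map_polyQ X Y W d hd hW] at h
  simp only [Polynomial.derivative_map, Polynomial.eval_map_algebraMap] at h
  rw [Polynomial.derivative_map]
  rw [h, offX, offY]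
  field_simp
  linear_combination 2 * (Polynomial.aeval (auxT X Y W) W * algebraMap ℝ (AuxField X Y W) d *
    auxA X Y W * (Polynomial.aeval (auxT X Y W) (hatV X Y W) * hUg -
      Polynomial.aeval (auxT X Y W) (hatU X Y W) * hVg) -
    Polynomial.aeval (auxT X Y W) (Polynomial.derivative W) * Polynomial.aeval (auxT X Y W) W ^ 2 *
      algebraMap ℝ (AuxField X Y W) d ^ 2 * hα2)

/-- A circle around a fixed point of the curve does not pass through the generic point of the
offset. -/
theorem map_polyQ_ne_zero (hW : W ≠ 0) :
    (polyQ X Y W d).map (genericHom X Y W d) ≠ 0 := by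
  intro h0
  obtain ⟨r, hr⟩ : ∃ r : ℝ, W.eval r ≠ 0 := by
    by_contra! h
    exact hW (Polynomial.funext fun r => by simpa using h r)
  have h := congrArg (Polynomial.eval (algebraMap ℝ (AuxField X Y W) r))
    (map_contQ_mul_map_polyQ X Y W d)
  simp only [h0, mul_zero, Polynomial.eval_zero, Polynomial.eval_add, Polynomial.eval_sub,
    Polynomial.eval_mul, Polynomial.eval_pow, Polynomial.eval_C, Polynomial.eval_map_algebraMap,
    Polynomial.aeval_algebraMap_apply, Polynomial.coe_aeval_eq_eval] at h
  set w := W.eval r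
  have hw := aeval_auxT_ne_zero X Y W hW
  have hα := auxA_ne_zero X Y W
  have hα2 := auxA_sq X Y W
  have key := aeval_add_mul_auxA_eq_zero X Y W
    (p := sumSq X Y W * ((Polynomial.C w * X - Polynomial.C (X.eval r) * W) ^ 2 +
      (Polynomial.C w * Y - Polynomial.C (Y.eval r) * W) ^ 2))
    (q := 2 * Polynomial.C w * Polynomial.C d * W *
      ((Polynomial.C w * X - Polynomial.C (X.eval r) * W) * hatV X Y W -
        (Polynomial.C w * Y - Polynomial.C (Y.eval r) * W) * hatU X Y W)) (by
      simp only [map_mul, map_add, map_sub, map_pow, Polynomial.aeval_C, map_ofNat]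
      rw [sumSq] at hα2 ⊢
      simp only [map_add, map_pow] at hα2 ⊢
      rw [offX, offY] at h
      field_simp at h
      linear_combination -h - ((algebraMap ℝ (AuxField X Y W) w * Polynomial.aeval (auxT X Y W) X -
          algebraMap ℝ (AuxField X Y W) (X.eval r) * Polynomial.aeval (auxT X Y W) W) ^ 2 +
        (algebraMap ℝ (AuxField X Y W) w * Polynomial.aeval (auxT X Y W) Y -
          algebraMap ℝ (AuxField X Y W) (Y.eval r) * Polynomial.aeval (auxT X Y W) W) ^ 2 -
        algebraMap ℝ (AuxField X Y W) w ^ 2 * Polynomial.aeval (auxT X Y W) W ^ 2 *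
          algebraMap ℝ (AuxField X Y W) d ^ 2) * hα2)
  have h1 := (mul_eq_zero.1 key.1).resolve_left (sumSq_ne_zero X Y W)
  have hx : Polynomial.C w * X - Polynomial.C (X.eval r) * W = 0 := Polynomial.funext fun z => by
    have := congrArg (Polynomial.eval z) h1
    simp only [Polynomial.eval_add, Polynomial.eval_pow, Polynomial.eval_zero] at this ⊢
    nlinarith [sq_nonneg ((Polynomial.C w * X - Polynomial.C (X.eval r) * W).eval z),
      sq_nonneg ((Polynomial.C w * Y - Polynomial.C (Y.eval r) * W).eval z)]
  have hy : Polynomial.C w * Y - Polynomial.C (Y.eval r) * W = 0 := Polynomial.funext fun z => by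
    have := congrArg (Polynomial.eval z) h1
    simp only [Polynomial.eval_add, Polynomial.eval_pow, Polynomial.eval_zero] at this ⊢
    nlinarith [sq_nonneg ((Polynomial.C w * X - Polynomial.C (X.eval r) * W).eval z),
      sq_nonneg ((Polynomial.C w * Y - Polynomial.C (Y.eval r) * W).eval z)]
  -- The parametrization would be constant.
  have hc : Polynomial.C w ≠ 0 := Polynomial.C_ne_zero.2 hr
  have hx' := congrArg Polynomial.derivative hx
  have hy' := congrArg Polynomial.derivative hy
  simp only [Polynomial.derivative_sub, Polynomial.derivative_C_mul, Polynomial.derivative_zero]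
    at hx' hy'
  refine gcdUV_ne_zero X Y W (EuclideanDomain.gcd_eq_zero_iff.2 ⟨?_, ?_⟩)
  · refine (mul_eq_zero.1 ?_).resolve_left hc
    rw [polyU]
    linear_combination W * hx' - W.derivative * hx
  · refine (mul_eq_zero.1 ?_).resolve_left hc
    rw [polyV]
    linear_combination W * hy' - W.derivative * hy

theorem one_le_natDegree_polyP (hd : d ≠ 0) (hW : W ≠ 0) : 1 ≤ (polyP X Y W).natDegree := by
  rw [← natDegree_map_polyP X Y W d hd hW]
  by_contra! h
  have h1 := Polynomial.eq_C_of_natDegree_le_zero (Nat.lt_one_iff.1 h).le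
  have h2 := eval_map_polyP X Y W d hd hW
  rw [h1, Polynomial.eval_C] at h2
  rw [h2, Polynomial.C_0] at h1
  exact map_polyP_ne_zero X Y W d hd hW h1

theorem two_le_natDegree_polyQ (hd : d ≠ 0) (hW : W ≠ 0) : 2 ≤ (polyQ X Y W d).natDegree := by
  refine le_trans ?_ (Polynomial.natDegree_map_le (f := genericHom X Y W d))
  by_contra! h
  obtain ⟨c₁, c₀, h1⟩ := Polynomial.exists_eq_X_add_C_of_natDegree_le_one (Nat.lt_succ_iff.1 h)
  have h2 := eval_map_polyQ X Y W d hd hW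
  have h3 := eval_derivative_map_polyQ X Y W d hd hW
  rw [h1] at h2 h3
  simp at h3
  rw [h3] at h2
  simp at h2
  rw [h2, h3] at h1
  exact map_polyQ_ne_zero X Y W d hW (by simpa using h1)

/-- At the generic point of the offset, the greatest common divisor of `P` and `Q` is linear. -/
theorem genericHom_sres₁_ne_zero (hproper : IsProper X Y W) (hd : d ≠ 0) (hW : W ≠ 0) :
    genericHom X Y W d (sres₁ X Y W d) ≠ 0 := by
  have hn := one_le_natDegree_polyP X Y W d hd hW
  have hm := two_le_natDegree_polyQ X Y W d hd hW
  obtain ⟨p, hp⟩ := Polynomial.dvd_iff_isRoot.2 (eval_map_polyP X Y W d hd hW)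
  obtain ⟨q, hq⟩ := Polynomial.dvd_iff_isRoot.2 (eval_map_polyQ X Y W d hd hW)
  have hp0 : p ≠ 0 := by
    rintro rfl
    exact map_polyP_ne_zero X Y W d hd hW (by rw [hp, mul_zero])
  -- A common root of the cofactors would be `t`, which is a simple root of `P`.
  have hpq : IsCoprime p q := by
    rw [Polynomial.isCoprime_iff_aeval_ne_zero_of_isAlgClosed (AuxField X Y W)
      (AlgebraicClosure (AuxField X Y W))]
    intro s
    by_contra! hs
    have hroot : ∀ f : (MvPolynomial (Fin 2) ℝ)[X],
        f.eval₂ (pointHom (algebraMap _ (AlgebraicClosure (AuxField X Y W)) (offX X Y W d))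
          (algebraMap _ _ (offY X Y W d))) s =
          Polynomial.aeval s (f.map (genericHom X Y W d)) := by
      intro f
      rw [Polynomial.aeval_def, Polynomial.eval₂_map]
      congr 1
      exact (pointHom_algHom (IsScalarTower.toAlgHom ℝ (AuxField X Y W)
        (AlgebraicClosure (AuxField X Y W))) _ _).symm
    have hst := eq_auxT_of_common_root X Y W d hproper hd hW (s := s)
      (by rw [hroot, hp, map_mul, hs.1, mul_zero]) (by rw [hroot, hq, map_mul, hs.2, mul_zero])
    have h1 := hs.1
    rw [hst, Polynomial.aeval_algebraMap_apply, map_eq_zero, Polynomial.coe_aeval_eq_eval] at h1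
    refine eval_derivative_map_polyP_ne_zero X Y W d hd hW ?_
    rw [hp]
    simp [h1]
  have h := subres_one_coeff_one_ne_zero hpq hp0 (auxT X Y W) (n := (polyP X Y W).natDegree)
    (m := (polyQ X Y W d).natDegree)
    (by
      rw [← natDegree_map_polyP X Y W d hd hW, hp,
        Polynomial.natDegree_mul (Polynomial.X_sub_C_ne_zero _) hp0, Polynomial.natDegree_X_sub_C,
        add_comm])
    (by rw [← hq]; exact Polynomial.natDegree_map_le) (by omega) (by omega)
  rw [← hp, ← hq, ← map_subres, Polynomial.coeff_map] at h
  exact h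

/-- A common zero of `P` and `Q` above a point is a zero of the first subresultant. -/
theorem sres₁_mul_add_sr_eq_zero (hd : d ≠ 0) (hW : W ≠ 0) {E : Type*} [Field E]
    (ψ : MvPolynomial (Fin 2) ℝ →+* E) {s : E} (hP : (polyP X Y W).eval₂ ψ s = 0)
    (hQ : (polyQ X Y W d).eval₂ ψ s = 0) : ψ (sres₁ X Y W d) * s + ψ (sr X Y W d) = 0 := by
  have hn := one_le_natDegree_polyP X Y W d hd hW
  have hm := two_le_natDegree_polyQ X Y W d hd hW
  have h := subres_one_eval_eq_zero (f := (polyP X Y W).map ψ) (g := (polyQ X Y W d).map ψ)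
    (n := (polyP X Y W).natDegree) (m := (polyQ X Y W d).natDegree) Polynomial.natDegree_map_le
    Polynomial.natDegree_map_le (by omega) (by omega) (s := s)
    (by rw [Polynomial.eval_map, hP]) (by rw [Polynomial.eval_map, hQ])
  rwa [← map_subres, Polynomial.coeff_map, Polynomial.coeff_map] at h

end

noncomputable section

/-! ### The ideal of the offset -/

/-- The value of a polynomial at the point `(n₀ / δ, n₁ / δ)` becomes a polynomial expression after
multiplication with a power of `δ`. -/
theorem exists_clear_denominators {σ : Type*} (δ : MvPolynomial σ ℝ)
    (n : Fin 2 → MvPolynomial σ ℝ) (G : MvPolynomial (Fin 2) ℝ) :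
    ∃ (N : ℕ) (G' : MvPolynomial σ ℝ), ∀ {E : Type} [Field E] [Algebra ℝ E]
      (e : MvPolynomial σ ℝ →ₐ[ℝ] E), e δ ≠ 0 →
        e G' = e δ ^ N * MvPolynomial.aeval (fun i => e (n i) / e δ) G := by
  induction G using MvPolynomial.induction_on with
  | C c => exact ⟨0, MvPolynomial.C c, fun e _ => by
      rw [pow_zero, one_mul, MvPolynomial.aeval_C, ← MvPolynomial.algebraMap_eq, e.commutes]⟩
  | add f g hf hg =>
    obtain ⟨N, f', hf⟩ := hf
    obtain ⟨M, g', hg⟩ := hg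
    refine ⟨N + M, δ ^ M * f' + δ ^ N * g', fun e he => ?_⟩
    rw [map_add, map_mul, map_mul, map_pow, map_pow, hf e he, hg e he, map_add]
    ring
  | mul_X f i hf =>
    obtain ⟨N, f', hf⟩ := hf
    refine ⟨N + 1, f' * n i, fun e he => ?_⟩
    rw [map_mul, hf e he, map_mul, MvPolynomial.aeval_X]
    field_simp
    ring

variable (X Y W : ℝ[X]) [hM : Fact (Irreducible (auxPoly X Y W))] (d : ℝ)

omit hM in
/-- A polynomial composed with `φ` is, up to a power of `W α`, a polynomial in `t` and `α`. -/
theorem exists_pullback (G : MvPolynomial (Fin 2) ℝ) :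
    ∃ (N : ℕ) (G' : MvPolynomial (Fin 2) ℝ), ∀ {E : Type} [Field E] [Algebra ℝ E] (s β : E),
      Polynomial.aeval s W ≠ 0 → β ≠ 0 → MvPolynomial.aeval ![s, β] G' =
        (Polynomial.aeval s W * β) ^ N * MvPolynomial.aeval
          ![Polynomial.aeval s X / Polynomial.aeval s W +
              algebraMap ℝ E d * (Polynomial.aeval s (hatV X Y W) / β),
            Polynomial.aeval s Y / Polynomial.aeval s W -
              algebraMap ℝ E d * (Polynomial.aeval s (hatU X Y W) / β)] G := by
  obtain ⟨N, G', hG⟩ := exists_clear_denominators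
    (Polynomial.aeval (MvPolynomial.X 0) W * MvPolynomial.X 1 : MvPolynomial (Fin 2) ℝ)
    ![Polynomial.aeval (MvPolynomial.X 0) X * MvPolynomial.X 1 + MvPolynomial.C d *
        Polynomial.aeval (MvPolynomial.X 0) (hatV X Y W) * Polynomial.aeval (MvPolynomial.X 0) W,
      Polynomial.aeval (MvPolynomial.X 0) Y * MvPolynomial.X 1 - MvPolynomial.C d *
        Polynomial.aeval (MvPolynomial.X 0) (hatU X Y W) * Polynomial.aeval (MvPolynomial.X 0) W] G
  refine ⟨N, G', fun {E} _ _ s β hs hβ => ?_⟩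
  have hδ : MvPolynomial.aeval ![s, β] (Polynomial.aeval (MvPolynomial.X 0) W * MvPolynomial.X 1 :
      MvPolynomial (Fin 2) ℝ) = Polynomial.aeval s W * β := by
    simp [aeval_aeval_X]
  rw [hG (MvPolynomial.aeval ![s, β]) (by rw [hδ]; exact mul_ne_zero hs hβ), hδ]
  congr 3
  funext i
  fin_cases i
  · simp [aeval_aeval_X]; field_simp
  · simp [aeval_aeval_X]; field_simp

omit hM in
/-- The points that generate the offset are values of `φ`, with `α = ± √(U² + V²) / gcd (U, V)`. -/
theorem exists_mapPoint_eq {p : Fin 2 → ℝ} (hp : p ∈ offsetPoints X Y W d) :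
    ∃ q ∈ mapDomain X Y W, mapPoint X Y W d q = p := by
  obtain ⟨t, ε, hW, hUV, hε, h0, h1⟩ := hp
  have hε2 : ε ^ 2 = 1 := by rcases hε with rfl | rfl <;> norm_num
  have hε0 : ε ≠ 0 := by rintro rfl; norm_num at hε2
  rw [← gcdUV_mul_hatU X Y W, ← gcdUV_mul_hatV X Y W] at hUV h0 h1
  simp only [Polynomial.eval_mul] at hUV h0 h1
  have hg : (gcdUV X Y W).eval t ≠ 0 := by
    intro h; rw [h] at hUV; simp at hUV
  have hpos : 0 < ((gcdUV X Y W).eval t * (hatU X Y W).eval t) ^ 2 +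
      ((gcdUV X Y W).eval t * (hatV X Y W).eval t) ^ 2 := lt_of_le_of_ne (by positivity) hUV.symm
  have hr := Real.sq_sqrt hpos.le
  have hr0 := (Real.sqrt_pos.2 hpos).ne'
  set r := √(((gcdUV X Y W).eval t * (hatU X Y W).eval t) ^ 2 +
      ((gcdUV X Y W).eval t * (hatV X Y W).eval t) ^ 2)
  refine ⟨![t, ε * r / (gcdUV X Y W).eval t], ⟨?_, hW, ?_⟩, ?_⟩
  · rw [mem_auxCurve_iff]
    simp only [Matrix.cons_val_zero, Matrix.cons_val_one, sumSq, Polynomial.eval_add,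
      Polynomial.eval_pow]
    field_simp
    rw [hε2, hr]
    ring
  · exact div_ne_zero (mul_ne_zero hε0 hr0) hg
  · funext i
    fin_cases i
    · simp only [mapPoint, Fin.zero_eta, Matrix.cons_val_zero, Matrix.cons_val_one, h0]
      field_simp
      linear_combination (-(W.eval t * d * (hatV X Y W).eval t * (gcdUV X Y W).eval t)) * hε2
    · simp only [mapPoint, Fin.mk_one, Matrix.cons_val_zero, Matrix.cons_val_one, h1]
      field_simp
      linear_combination (W.eval t * d * (hatU X Y W).eval t * (gcdUV X Y W).eval t) * hε2

omit hM in
/-- The values of `φ` are points that generate the offset, except over the finitely many common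
zeros of `U` and `V`, where `φ` is still defined. -/
theorem mapPoint_mem_offsetPoints {q : Fin 2 → ℝ} (hq : q ∈ mapDomain X Y W)
    (hg : (gcdUV X Y W).eval (q 0) ≠ 0) : mapPoint X Y W d q ∈ offsetPoints X Y W d := by
  obtain ⟨hc, hW, hα⟩ := hq
  rw [mem_auxCurve_iff] at hc
  simp only [sumSq, Polynomial.eval_add, Polynomial.eval_pow] at hc
  have hsum : (polyU X W).eval (q 0) ^ 2 + (polyV Y W).eval (q 0) ^ 2 =
      ((gcdUV X Y W).eval (q 0) * q 1) ^ 2 := by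
    rw [← gcdUV_mul_hatU X Y W, ← gcdUV_mul_hatV X Y W, mul_pow, hc]
    simp only [Polynomial.eval_mul]
    ring
  have hgα := mul_ne_zero hg hα
  have habs := abs_ne_zero.2 hgα
  have habs2 := sq_abs ((gcdUV X Y W).eval (q 0) * q 1)
  refine ⟨q 0, (gcdUV X Y W).eval (q 0) * q 1 / |(gcdUV X Y W).eval (q 0) * q 1|, hW,
    by rw [hsum]; exact pow_ne_zero 2 hgα, ?_, ?_, ?_⟩
  · rcases abs_choice ((gcdUV X Y W).eval (q 0) * q 1) with h | h
    · left; rw [h, div_self hgα]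
    · right; rw [h, div_neg, div_self hgα]
  · rw [hsum, Real.sqrt_sq_eq_abs, ← gcdUV_mul_hatV X Y W]
    simp only [mapPoint, Matrix.cons_val_zero, Polynomial.eval_mul]
    generalize |(gcdUV X Y W).eval (q 0) * q 1| = r at *
    congr 1
    field_simp
    rw [habs2]
    ring
  · rw [hsum, Real.sqrt_sq_eq_abs, ← gcdUV_mul_hatU X Y W]
    simp only [mapPoint, Matrix.cons_val_zero, Matrix.cons_val_one, Polynomial.eval_mul]
    generalize |(gcdUV X Y W).eval (q 0) * q 1| = r at *
    congr 1
    field_simp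
    rw [habs2]
    ring

/-- The equations of the offset are the algebraic relations between the coordinates of its generic
point. -/
theorem aeval_offXY_eq_zero_iff (hW : W ≠ 0) (G : MvPolynomial (Fin 2) ℝ) :
    MvPolynomial.aeval ![offX X Y W d, offY X Y W d] G = 0 ↔
      ∀ p ∈ offsetPoints X Y W d, MvPolynomial.eval p G = 0 := by
  obtain ⟨N, G', hG⟩ := exists_pullback X Y W d G
  have hreal : ∀ q ∈ mapDomain X Y W, MvPolynomial.eval q G' =
      (W.eval (q 0) * q 1) ^ N * MvPolynomial.eval (mapPoint X Y W d q) G := by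
    intro q hq
    have := hG (q 0) (q 1) hq.2.1 hq.2.2
    have e : ![q 0, q 1] = q := by funext i; fin_cases i <;> rfl
    rw [e] at this
    exact this
  have hgen := hG (auxT X Y W) (auxA X Y W) (aeval_auxT_ne_zero X Y W hW) (auxA_ne_zero X Y W)
  rw [← offX, ← offY] at hgen
  have hne : (Polynomial.aeval (auxT X Y W) W * auxA X Y W) ^ N ≠ 0 :=
    pow_ne_zero _ (mul_ne_zero (aeval_auxT_ne_zero X Y W hW) (auxA_ne_zero X Y W))
  constructor
  · intro h p hp
    obtain ⟨q, hq, rfl⟩ := exists_mapPoint_eq X Y W d hp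
    rw [h, mul_zero] at hgen
    have := hreal q hq
    rw [(aeval_aux_eq_zero_iff X Y W G').1 hgen q hq.1] at this
    exact (mul_eq_zero.1 this.symm).resolve_left
      (pow_ne_zero _ (mul_ne_zero hq.2.1 hq.2.2))
  · intro h
    -- The factor `W gcd (U, V)` removes the points of `M` that give no point of `offsetPoints`.
    have h1 := (aeval_aux_eq_zero_iff X Y W
      (G' * Polynomial.aeval (MvPolynomial.X 0) (W * gcdUV X Y W))).2 fun q hq => by
      rw [map_mul, eval_aeval_X, Polynomial.eval_mul]
      by_cases hw : W.eval (q 0) = 0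
      · rw [hw, zero_mul, mul_zero]
      by_cases hg : (gcdUV X Y W).eval (q 0) = 0
      · rw [hg, mul_zero, mul_zero]
      have hq' : q ∈ mapDomain X Y W := by
        refine ⟨hq, hw, fun h0 => ?_⟩
        rw [mem_auxCurve_iff, h0] at hq
        have := sumSq_eval_pos X Y W (q 0)
        rw [← hq] at this
        norm_num at this
      rw [hreal q hq', h _ (mapPoint_mem_offsetPoints X Y W d hq' hg), mul_zero, zero_mul]
    rw [map_mul, aeval_aeval_X] at h1
    have h2 := (mul_eq_zero.1 h1).resolve_right
      (aeval_auxT_ne_zero X Y W (mul_ne_zero hW (gcdUV_ne_zero X Y W)))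
    rw [h2] at hgen
    exact (mul_eq_zero.1 hgen.symm).resolve_left hne

theorem eval_eq_zero_of_mem_offset (hW : W ≠ 0) {G : MvPolynomial (Fin 2) ℝ}
    (hG : MvPolynomial.aeval ![offX X Y W d, offY X Y W d] G = 0) {p : Fin 2 → ℝ}
    (hp : p ∈ offset X Y W d) : MvPolynomial.eval p G = 0 :=
  hp G fun q hq => (aeval_offXY_eq_zero_iff X Y W d hW G).1 hG q hq

theorem mem_offsetIdeal_iff (hW : W ≠ 0) (G : MvPolynomial (Fin 2) ℝ) :
    G ∈ offsetIdeal X Y W d ↔ MvPolynomial.aeval ![offX X Y W d, offY X Y W d] G = 0 := by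
  constructor
  · intro h
    exact (aeval_offXY_eq_zero_iff X Y W d hW G).2 fun p hp =>
      h p (MvPolynomial.zeroLocus_vanishingIdeal_le _ hp)
  · intro h p hp
    exact eval_eq_zero_of_mem_offset X Y W d hW h hp

theorem offsetIdeal_isPrime (hW : W ≠ 0) : (offsetIdeal X Y W d).IsPrime := by
  have : offsetIdeal X Y W d = RingHom.ker (genericHom X Y W d) :=
    Ideal.ext fun G => mem_offsetIdeal_iff X Y W d hW G
  rw [this]
  exact RingHom.ker_isPrime _

/-! ### The inverse of the parametrization of the offset -/

/-- The function `t` is a rational function of the coordinates of the generic point. -/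
theorem auxT_eq (hproper : IsProper X Y W) (hd : d ≠ 0) (hW : W ≠ 0) :
    auxT X Y W = -(genericHom X Y W d (sr X Y W d) / genericHom X Y W d (sres₁ X Y W d)) := by
  obtain ⟨hP, hQ⟩ := generic_mem_polyP_polyQ X Y W d hd hW
  have h := sres₁_mul_add_sr_eq_zero X Y W d hd hW (genericHom X Y W d) hP hQ
  have h0 := genericHom_sres₁_ne_zero X Y W d hproper hd hW
  rw [eq_comm, neg_eq_iff_eq_neg, div_eq_iff h0]
  linear_combination h

/-- The field isomorphism `φ^*`. -/
theorem exists_algEquiv (hproper : IsProper X Y W) (hd : d ≠ 0) (hW : W ≠ 0)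
    [hp : (offsetIdeal X Y W d).IsPrime] :
    ∃ Φ : FunField (offsetIdeal X Y W d) ≃ₐ[ℝ] AuxField X Y W,
      ∀ G, Φ (ratFun (offsetIdeal X Y W d) G) = genericHom X Y W d G := by
  let g : (MvPolynomial (Fin 2) ℝ ⧸ offsetIdeal X Y W d) →ₐ[ℝ] AuxField X Y W :=
    Ideal.Quotient.liftₐ _ (MvPolynomial.aeval ![offX X Y W d, offY X Y W d])
      fun G hG => (mem_offsetIdeal_iff X Y W d hW G).1 hG
  have hg : Function.Injective g := by
    rw [injective_iff_map_eq_zero]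
    intro x hx
    obtain ⟨G, rfl⟩ := Ideal.Quotient.mk_surjective x
    exact Ideal.Quotient.eq_zero_iff_mem.2 ((mem_offsetIdeal_iff X Y W d hW G).2 hx)
  obtain ⟨Φ, hΦ⟩ : ∃ Φ : FunField (offsetIdeal X Y W d) →ₐ[ℝ] AuxField X Y W,
      ∀ G, Φ (ratFun (offsetIdeal X Y W d) G) = genericHom X Y W d G :=
    ⟨IsFractionRing.liftAlgHom hg, fun G => IsFractionRing.lift_algebraMap (g := g.toRingHom) hg _⟩
  obtain ⟨τ, hτ⟩ : ∃ τ, Φ τ = auxT X Y W :=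
    ⟨-(ratFun _ (sr X Y W d) / ratFun _ (sres₁ X Y W d)), by
      rw [map_neg, map_div₀, hΦ, hΦ, ← auxT_eq X Y W d hproper hd hW]⟩
  have hτf : ∀ f : ℝ[X], Φ (Polynomial.aeval τ f) = Polynomial.aeval (auxT X Y W) f := fun f => by
    rw [← Polynomial.aeval_algHom_apply, hτ]
  -- Since `x - X / W = d V̂ / α` and `V̂ ≠ 0`, the function `α` is in the image as well.
  obtain ⟨κ, hκ⟩ : ∃ κ, Φ κ = auxA X Y W := by
    refine ⟨algebraMap ℝ _ d * Polynomial.aeval τ (hatV X Y W) /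
      (ratFun _ (MvPolynomial.X 0) - Polynomial.aeval τ X / Polynomial.aeval τ W), ?_⟩
    have hx : genericHom X Y W d (MvPolynomial.X 0) = offX X Y W d := by
      simp [genericHom, pointHom]
    have hd' : algebraMap ℝ (AuxField X Y W) d ≠ 0 := by simpa using hd
    have hV := aeval_auxT_ne_zero X Y W (hatV_ne_zero X Y W)
    have hα := auxA_ne_zero X Y W
    rw [map_div₀, map_mul, map_sub, map_div₀, hτf, hτf, hτf, hΦ, hx, AlgHom.commutes, offX,
      add_sub_cancel_left]
    field_simp
  have hsurj : Function.Surjective Φ := by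
    intro z
    obtain ⟨f, h, -, rfl⟩ := exists_eq_div X Y W z
    have hΦf : ∀ f : MvPolynomial (Fin 2) ℝ, Φ (MvPolynomial.aeval ![τ, κ] f) =
        MvPolynomial.aeval ![auxT X Y W, auxA X Y W] f := by
      intro f
      have : Φ.comp (MvPolynomial.aeval ![τ, κ]) =
          MvPolynomial.aeval ![auxT X Y W, auxA X Y W] := by
        refine MvPolynomial.algHom_ext fun i => ?_
        fin_cases i <;> simp [hτ, hκ]
      exact DFunLike.congr_fun this f
    exact ⟨MvPolynomial.aeval ![τ, κ] f / MvPolynomial.aeval ![τ, κ] h, by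
      rw [map_div₀, hΦf, hΦf]⟩
  exact ⟨AlgEquiv.ofBijective Φ ⟨Φ.injective, hsurj⟩, hΦ⟩

/-! ### Real points of the offset -/

/-- An equation satisfied by the rational function `t = - sr / sres₁` on the offset holds at every
point where the denominator does not vanish. -/
theorem eval₂_eq_zero_of_mem_offset (hproper : IsProper X Y W) (hd : d ≠ 0) (hW : W ≠ 0)
    {F : (MvPolynomial (Fin 2) ℝ)[X]} (hF : F.eval₂ (genericHom X Y W d) (auxT X Y W) = 0)
    {p : Fin 2 → ℝ} (hp : p ∈ offset X Y W d) (hs : MvPolynomial.eval p (sres₁ X Y W d) ≠ 0) :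
    F.eval₂ (MvPolynomial.eval p) (-(MvPolynomial.eval p (sr X Y W d) /
      MvPolynomial.eval p (sres₁ X Y W d))) = 0 := by
  set n := F.natDegree
  -- `F(- sr / sres₁)` with denominators cleared.
  set G : MvPolynomial (Fin 2) ℝ := ∑ j ∈ Finset.range (n + 1),
    F.coeff j * (-sr X Y W d) ^ j * sres₁ X Y W d ^ (n - j) with hG
  have key : ∀ {E : Type} [Field E] (ψ : MvPolynomial (Fin 2) ℝ →+* E), ψ (sres₁ X Y W d) ≠ 0 →
      ψ G = ψ (sres₁ X Y W d) ^ n *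
        F.eval₂ ψ (-(ψ (sr X Y W d) / ψ (sres₁ X Y W d))) := by
    intro E _ ψ hψ
    rw [Polynomial.eval₂_eq_sum_range, hG, map_sum, Finset.mul_sum]
    refine Finset.sum_congr rfl fun j hj => ?_
    have hj' : n = (n - j) + j := by
      have := Finset.mem_range.1 hj
      omega
    rw [map_mul, map_mul, map_pow, map_pow, map_neg, ← neg_div, div_pow]
    conv_rhs => rw [hj', pow_add]
    field_simp
  have h1 := key (genericHom X Y W d) (genericHom_sres₁_ne_zero X Y W d hproper hd hW)
  rw [← auxT_eq X Y W d hproper hd hW, hF, mul_zero] at h1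
  have h2 := key (MvPolynomial.eval p) hs
  rw [eval_eq_zero_of_mem_offset X Y W d hW h1 hp] at h2
  exact (mul_eq_zero.1 h2.symm).resolve_left (pow_ne_zero _ hs)

omit hM in
theorem eval_ne_zero_of_isUnit_gcd
    (hgcd : IsUnit (EuclideanDomain.gcd (EuclideanDomain.gcd X Y) W)) {t : ℝ} (hw : W.eval t = 0) :
    X.eval t ^ 2 + Y.eval t ^ 2 ≠ 0 := by
  intro h
  have hx : X.eval t = 0 := by nlinarith [sq_nonneg (X.eval t), sq_nonneg (Y.eval t)]
  have hy : Y.eval t = 0 := by nlinarith [sq_nonneg (X.eval t), sq_nonneg (Y.eval t)]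
  refine Polynomial.not_isUnit_X_sub_C t (isUnit_of_dvd_unit ?_ hgcd)
  exact EuclideanDomain.dvd_gcd (EuclideanDomain.dvd_gcd (Polynomial.dvd_iff_isRoot.2 hx)
    (Polynomial.dvd_iff_isRoot.2 hy)) (Polynomial.dvd_iff_isRoot.2 hw)

omit hM in
theorem pointHom_eq_eval (p : Fin 2 → ℝ) : pointHom (p 0) (p 1) = MvPolynomial.eval p := by
  have e : ![p 0, p 1] = p := by funext i; fin_cases i <;> rfl
  refine RingHom.ext fun f => ?_
  rw [pointHom_apply, e, MvPolynomial.aeval_eq_eval]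

/-- The points `φ(q)` are the common real zeros of `P` and `Q`. -/
theorem mapPoint_eq_iff (hd : d ≠ 0) {p : Fin 2 → ℝ} {t : ℝ} (hw : W.eval t ≠ 0) :
    ((polyP X Y W).eval₂ (MvPolynomial.eval p) t = 0 ∧
      (polyQ X Y W d).eval₂ (MvPolynomial.eval p) t = 0) ↔
      ∃ β, ![t, β] ∈ mapDomain X Y W ∧ mapPoint X Y W d ![t, β] = p := by
  rw [← pointHom_eq_eval, eval₂_polyP_polyQ_eq_zero_iff X Y W d hd hw
    (sumSq_eval_pos X Y W t).ne']
  refine exists_congr fun β => ?_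
  rw [mapDomain, Set.mem_ofPred_eq, mem_auxCurve_iff]
  constructor
  · rintro ⟨h1, h2, h3, h4⟩
    refine ⟨⟨h2, hw, h1⟩, ?_⟩
    funext i
    fin_cases i
    · exact h3.symm
    · exact h4.symm
  · rintro ⟨⟨h2, -, h1⟩, rfl⟩
    exact ⟨h1, h2, rfl, rfl⟩

/-- Since `Û(t)` and `V̂(t)` are not both zero, `φ(t, α)` determines `α` for given `t`. -/
theorem snd_eq_of_mapPoint_eq (hd : d ≠ 0) {t β β' : ℝ} (hβ : β ≠ 0) (hβ' : β' ≠ 0)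
    (h : mapPoint X Y W d ![t, β] = mapPoint X Y W d ![t, β']) : β = β' := by
  have h0 := congrFun h 0
  have h1 := congrFun h 1
  simp only [mapPoint, Matrix.cons_val_zero, Matrix.cons_val_one, add_right_inj, sub_right_inj,
    mul_eq_mul_left_iff, hd, or_false] at h0 h1
  have hpos := sumSq_eval_pos X Y W t
  simp only [sumSq, Polynomial.eval_add, Polynomial.eval_pow] at hpos
  rw [div_eq_div_iff hβ hβ'] at h0 h1
  by_cases hV : (hatV X Y W).eval t = 0
  · have hU : (hatU X Y W).eval t ≠ 0 := by
      intro hU; rw [hU, hV] at hpos; norm_num at hpos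
    exact (mul_left_cancel₀ hU h1).symm
  · exact (mul_left_cancel₀ hV h0).symm

end

end OffsetCurve

theorem mainTheorem3 (X Y W : ℝ[X]) (d : ℝ) (hd : 0 < d) (hW : W ≠ 0)
    (hgcd : IsUnit (EuclideanDomain.gcd (EuclideanDomain.gcd X Y) W))
    (hproper : OffsetCurve.IsProper X Y W)
    [hM : Fact (Irreducible (OffsetCurve.auxPoly X Y W))] :
    (∃ _ : (OffsetCurve.offsetIdeal X Y W d).IsPrime,
      OffsetCurve.ratFun (OffsetCurve.offsetIdeal X Y W d) (OffsetCurve.sres₁ X Y W d) ≠ 0 ∧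
      ∃ Φ : OffsetCurve.FunField (OffsetCurve.offsetIdeal X Y W d) ≃ₐ[ℝ]
          OffsetCurve.FunField (OffsetCurve.auxIdeal X Y W),
        Φ (OffsetCurve.ratFun (OffsetCurve.offsetIdeal X Y W d) (MvPolynomial.X 0)) =
          OffsetCurve.mapX X Y W d ∧
        Φ (OffsetCurve.ratFun (OffsetCurve.offsetIdeal X Y W d) (MvPolynomial.X 1)) =
          OffsetCurve.mapY X Y W d ∧
        Φ.symm (OffsetCurve.ratFun (OffsetCurve.auxIdeal X Y W) (MvPolynomial.X 0)) =
          -(OffsetCurve.ratFun (OffsetCurve.offsetIdeal X Y W d) (OffsetCurve.sr X Y W d) /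
            OffsetCurve.ratFun (OffsetCurve.offsetIdeal X Y W d) (OffsetCurve.sres₁ X Y W d))) ∧
    ∀ p ∈ OffsetCurve.offset X Y W d,
      MvPolynomial.eval p (OffsetCurve.sres₁ X Y W d) ≠ 0 →
      ∃ q : Fin 2 → ℝ,
        (∀ q' : Fin 2 → ℝ, (q' ∈ OffsetCurve.mapDomain X Y W ∧
          OffsetCurve.mapPoint X Y W d q' = p) ↔ q' = q) ∧
        q 0 = -(MvPolynomial.eval p (OffsetCurve.sr X Y W d) /
          MvPolynomial.eval p (OffsetCurve.sres₁ X Y W d)) := by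
  have hd0 := hd.ne'
  constructor
  · have hprime := OffsetCurve.offsetIdeal_isPrime X Y W d hW
    refine ⟨hprime, ?_, ?_⟩
    · rw [Ne, OffsetCurve.ratFun_eq_zero_iff, OffsetCurve.mem_offsetIdeal_iff X Y W d hW]
      exact OffsetCurve.genericHom_sres₁_ne_zero X Y W d hproper hd0 hW
    · obtain ⟨Φ, hΦ⟩ := OffsetCurve.exists_algEquiv X Y W d hproper hd0 hW
      refine ⟨Φ, (hΦ _).trans ?_, (hΦ _).trans ?_, ?_⟩
      · refine (MvPolynomial.aeval_X _ _).trans ?_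
        rw [OffsetCurve.mapX, OffsetCurve.auxFun_eq, OffsetCurve.auxFun_eq, OffsetCurve.auxFun_eq]
        rfl
      · refine (MvPolynomial.aeval_X _ _).trans ?_
        rw [OffsetCurve.mapY, OffsetCurve.auxFun_eq, OffsetCurve.auxFun_eq, OffsetCurve.auxFun_eq]
        rfl
      · refine Φ.injective ((Φ.apply_symm_apply _).trans ?_)
        rw [map_neg, map_div₀, hΦ, hΦ]
        exact OffsetCurve.auxT_eq X Y W d hproper hd0 hW
  · intro p hp hs
    obtain ⟨hP, hQ⟩ := OffsetCurve.generic_mem_polyP_polyQ X Y W d hd0 hW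
    have hP' := OffsetCurve.eval₂_eq_zero_of_mem_offset X Y W d hproper hd0 hW hP hp hs
    have hQ' := OffsetCurve.eval₂_eq_zero_of_mem_offset X Y W d hproper hd0 hW hQ hp hs
    set t := -(MvPolynomial.eval p (OffsetCurve.sr X Y W d) /
      MvPolynomial.eval p (OffsetCurve.sres₁ X Y W d)) with ht
    -- At a real zero of `W`, the polynomial `Q` takes the value `X² + Y² ≠ 0`, up to a factor.
    have hw : W.eval t ≠ 0 := by
      intro hw
      have h := OffsetCurve.aeval_contQ_mul_eval₂_polyQ X Y W d (p 0) (p 1) t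
      rw [OffsetCurve.pointHom_eq_eval, hQ'] at h
      simp only [Polynomial.coe_aeval_eq_eval, hw] at h
      refine OffsetCurve.eval_ne_zero_of_isUnit_gcd X Y W hgcd hw ?_
      linear_combination -h
    obtain ⟨β, hβ, hβp⟩ := (OffsetCurve.mapPoint_eq_iff X Y W d hd0 hw).1 ⟨hP', hQ'⟩
    refine ⟨![t, β], fun q' => ⟨?_, ?_⟩, rfl⟩
    · rintro ⟨hq', hq'p⟩
      have e : ![q' 0, q' 1] = q' := by funext i; fin_cases i <;> rfl
      rw [← e] at hq' hq'p
      obtain ⟨hP1, hQ1⟩ := (OffsetCurve.mapPoint_eq_iff X Y W d hd0 hq'.2.1).2 ⟨_, hq', hq'p⟩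
      have h := OffsetCurve.sres₁_mul_add_sr_eq_zero X Y W d hd0 hW _ hP1 hQ1
      simp only [Matrix.cons_val_zero] at h
      have ht' : q' 0 = t := by
        rw [ht, eq_comm, neg_eq_iff_eq_neg, div_eq_iff hs]
        linear_combination h
      rw [ht'] at hq' hq'p
      have hβ' : q' 1 = β := OffsetCurve.snd_eq_of_mapPoint_eq X Y W d hd0 hq'.2.2 hβ.2.2
        (hq'p.trans hβp.symm)
      rw [← e, ht', hβ']
    · rintro rfl
      exact ⟨hβ, hβp⟩
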